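/- Let $H=(W,F)$ be a finite multigraph (parallel edges allowed) with $|W|>1$. For $w\in W$ let $\delta(w)$ be the set of edges incident to $w$, for $L\subseteq W$ let $F[L]$ be the set of edges with both endpoints in $L$, and for $x\in\mathbb{R}^F$, $U\subseteq F$ put $x(U)=\sum_{f\in U}x(f)$. For every $w\in W$ let $N_w$ be a matroid with ground set $\delta(w)$ and rank function $r_w$ (the current degree constraint at $w$). An edge $f\in\delta(w)$ is *free* in $N_w$ if $I\cup\{f\}$ is independent in $N_w$ for every independent set $I$ of $N_w$, and *contained in the degree constraint* $N_w$ otherwise. Let $F_2\subseteq F$ be the set of edges that are contained in the degree constraints at both of their endpoints, and let $Y$ be the set of nodes incident to at least one edge of $F_2$. Let $P_{st}=\{x\in\mathbb{R}^F_{\ge 0} : x(F)=|W|-1,\ x(F[L])\le |L|-1\ \ \forall\,\emptyset\ne L\subseteq W\}$ be the spanning tree polytope of $H$, and let $P_{N_w}=\{y\in\mathbb{R}^{\delta(w)}_{\ge 0} : y(C)\le r_w(C)\ \ \forall\, C\subseteq\delta(w)\}$ be the matroid polytope of $N_w$. Let $(LP1)$ be a linear program with the constraints $x\in P_{st}$ and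 $x|_{\delta(w)}\in P_{N_w}$ for all $w\in W$, possibly together with equalities $x(F[L])=|L|-1$ for the members $L$ of some family of nonempty subsets of $W$ (the fixed spanning tree constraints). Let $x$ be a basic solution of $(LP1)$, i.e. an extreme point of its feasible region, with $x(f)\notin\{0,1\}$ for all $f\in F$ (edges of value $0$ have been deleted and edges of value $1$ have been contracted). Let $Q\subseteq W$ be obtained by the following procedure: start with $Q=\emptyset$, and as long as there is a node $w\in W\setminus Q$ with $x(\delta(w)\cap F[W\setminus Q])=1$, add such a node to $Q$. Suppose that no type B degree adaptation is possible: for every $w\in W$, the set $U\subseteq\delta(w)$ of all edges that are contained in $N_w$ and are not incident to a node of $Q$ is empty or satisfies $|U|-x(U)>4$. Then there is a node $w\in Y$ to which a type A degree adaptation can be applied: the set $U=\delta(w)\cap F_2$ is nonempty and satisfies $|U|-x(U)\le 4$. -/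

import Mathlib

namespace MatroidalMST

/-- `x(U) = ∑_{f ∈ U} x(f)`. -/
noncomputable def weight {F : Type*} [Fintype F] (x : F → ℝ) (U : Set F) : ℝ :=
  ∑ f, U.indicator x f

/-- `F[L]`: the edges of the multigraph `H` with both endpoints in `L`. -/
def inducedEdges {W F : Type*} (H : Graph W F) (L : Set W) : Set F :=
  (H.induce L).edgeSet

/-- The spanning tree polytope `P_st` of a finite multigraph `H` whose node set is all of `W` and
whose edge set is all of `F`: nonnegativity, `x(F) = |W| - 1`, and the spanning tree constraints
`x(F[L]) ≤ |L| - 1` for all nonempty `L ⊆ W`. -/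
def spanningTreePolytope {W F : Type*} [Fintype F] (H : Graph W F) : Set (F → ℝ) :=
  {x | (∀ f, 0 ≤ x f) ∧
    weight x H.edgeSet = (H.vertexSet.ncard : ℝ) - 1 ∧
    ∀ L : Set W, L.Nonempty → L ⊆ H.vertexSet →
      weight x (inducedEdges H L) ≤ (L.ncard : ℝ) - 1}

/-- The vectors `x` whose restriction to the ground set of `M` is in the matroid polytope `P_M`,
i.e. `x ≥ 0` on the ground set and `x(C) ≤ r_M(C)` for every subset `C` of the ground set.
Coordinates outside of the ground set are not constrained. -/
def matroidPolytope {F : Type*} [Fintype F] (M : Matroid F) : Set (F → ℝ) :=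
  {x | (∀ f ∈ M.E, 0 ≤ x f) ∧ ∀ C ⊆ M.E, weight x C ≤ ((M.eRk C).toNat : ℝ)}

/-- The feasible region of `(LP1)` for the graph `H` with degree constraints `N w` (matroids on
`δ(w)`), where the spanning tree constraints of the sets `L ∈ fixed` have been fixed, that is,
have to be satisfied with equality. -/
def feasibleRegion {W F : Type*} [Fintype F] (H : Graph W F) (N : W → Matroid F)
    (fixed : Set (Set W)) : Set (F → ℝ) :=
  {x | x ∈ spanningTreePolytope H ∧
    (∀ w ∈ H.vertexSet, x ∈ matroidPolytope (N w)) ∧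
    ∀ L ∈ fixed, weight x (inducedEdges H L) = (L.ncard : ℝ) - 1}

/-- A basic solution of `(LP1)`: a vertex (extreme point) of its feasible region. -/
def IsBasicSolution {W F : Type*} [Fintype F] (H : Graph W F) (N : W → Matroid F)
    (fixed : Set (Set W)) (x : F → ℝ) : Prop :=
  x ∈ (feasibleRegion H N fixed).extremePoints ℝ

/-- `f` is a free element of the matroid `M`: adding it keeps independent sets independent. -/
def IsFreeElement {F : Type*} (M : Matroid F) (f : F) : Prop :=
  f ∈ M.E ∧ ∀ I, M.Indep I → M.Indep (insert f I)

/-- The edge `f` is contained in the degree constraint `M` (a matroid on `δ(w)`) if it is an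
element of `δ(w)` that is not free. -/
def IsContained {F : Type*} (M : Matroid F) (f : F) : Prop :=
  f ∈ M.E ∧ ¬ IsFreeElement M f

/-- `F₂`: the edges that are contained in both degree constraints, i.e. in the degree constraint
at each of their endpoints. -/
def edgesInBoth {W F : Type*} (H : Graph W F) (N : W → Matroid F) : Set F :=
  {f | f ∈ H.edgeSet ∧ ∀ w, H.Inc f w → IsContained (N w) f}

/-- The sets that can occur during the iterative construction of `Q(H, x)`: start with `∅`, and
add a node `w` whenever `x(δ(w) ∩ F[W \ Q]) = 1`. -/
inductive IsPartialQ {W F : Type*} [Fintype F] (H : Graph W F) (x : F → ℝ) : Set W → Prop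
  | empty : IsPartialQ H x ∅
  | add (Q : Set W) (w : W) : IsPartialQ H x Q → w ∈ H.vertexSet → w ∉ Q →
      weight x (H.incidenceSet w ∩ inducedEdges H (H.vertexSet \ Q)) = 1 →
      IsPartialQ H x (insert w Q)

/-- `Q` is a result of the iterative construction of `Q(H, x)`: it is reached by the construction
and no further node can be added. -/
def IsQ {W F : Type*} [Fintype F] (H : Graph W F) (x : F → ℝ) (Q : Set W) : Prop :=
  IsPartialQ H x Q ∧ ∀ w ∈ H.vertexSet, w ∉ Q →
    weight x (H.incidenceSet w ∩ inducedEdges H (H.vertexSet \ Q)) ≠ 1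

/-- The set `U ⊆ δ(w)` of a type A adaptation at `w`: the edges at `w` that are contained in both
degree constraints. -/
def typeASet {W F : Type*} (H : Graph W F) (N : W → Matroid F) (w : W) : Set F :=
  H.incidenceSet w ∩ edgesInBoth H N

/-- The set `U ⊆ δ(w)` of a type B adaptation at `w`: the edges at `w` that are contained in the
degree constraint `N w` and are not adjacent to a node in `Q`. -/
def typeBSet {W F : Type*} (H : Graph W F) (N : W → Matroid F) (Q : Set W) (w : W) : Set F :=
  {f | f ∈ H.incidenceSet w ∧ IsContained (N w) f ∧ ∀ q ∈ Q, ¬ H.Inc f q}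

/-- The condition under which a set `U` is removed from a degree constraint: `U` is nonempty and
`|U| - x(U) ≤ 4`. -/
def IsRemovable {F : Type*} [Fintype F] (x : F → ℝ) (U : Set F) : Prop :=
  U.Nonempty ∧ (U.ncard : ℝ) - weight x U ≤ 4

/-- A type A degree adaptation can be applied to the node `w`. -/
def TypeAApplicable {W F : Type*} [Fintype F] (H : Graph W F) (N : W → Matroid F) (x : F → ℝ)
    (w : W) : Prop :=
  IsRemovable x (typeASet H N w)

/-- A type B degree adaptation can be applied to the node `w`. -/
def TypeBApplicable {W F : Type*} [Fintype F] (H : Graph W F) (N : W → Matroid F) (x : F → ℝ)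
    (Q : Set W) (w : W) : Prop :=
  IsRemovable x (typeBSet H N Q w)

/-- `Y`: the nodes incident to an edge that is contained in both degree constraints. -/
def nodesY {W F : Type*} (H : Graph W F) (N : W → Matroid F) : Set W :=
  {w | w ∈ H.vertexSet ∧ (H.incidenceSet w ∩ edgesInBoth H N).Nonempty}

end MatroidalMST

/-! Suppose that neither adaptation is possible. As `x` has no coordinate at a bound, it is
determined by its tight constraints. The tight sets of the graphic matroid, and those of each `N w`,
are closed under union and intersection, so vanishing on such a family follows from vanishing on its
atoms (`pieces`). An atom is a difference of two tight sets, so its `x`-weight is a positive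
integer. Hence |F| ≤ l + ∑ k_w (`IsBasicSolution.card_le`), where l counts the spanning tree atoms
and k_w the atoms of `N w`. Moreover k_w ≤ x(D_w), where D_w is the set of edges contained in `N w`:
no free edge lies in a tight set. The contradiction is l + ∑ x(D_w) < |F|
(`IsSpanningTreePoint.card_lt`).

The sum ∑ x(D_w) is at most x(F) + x(F₂) minus the weight of the edges contained at neither end.
Failure of type A gives 2|Y| < |F₂| - x(F₂). It remains to find, up to controlled corrections, two
edges outside F₂ per node outside Y. A node of Q is removed with weight 1 spread over at least two
fractional edges (`IsPartialQ.invariants`). Among the other nodes, failure of type B gives either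
much slack or no contained edge in F[W \ Q]. A node of the latter kind has remaining weight above 1,
hence degree at least 2. Degree 3 suffices. At degree 2, both edges lie in one atom, of integral
weight at least 2, which is paid for by x(F) - l (`IsSpanningTreePoint.card_degree_two_le`).

Strictness requires Y to be nonempty (`IsBasicSolution.edgesInBoth_nonempty`): if F₂ were empty,
weighing the degree atoms by 1 - x would leave no room for the linear dependence between two
partitions of F. -/

namespace MatroidalMST

/-! ### Weights of sets and double counting -/

section Weight

variable {F : Type*} [Fintype F]

open Classical in
lemma weight_eq_sum (x : F → ℝ) (U : Set F) : weight x U = ∑ f with f ∈ U, x f := by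
  simp [weight, Set.indicator_apply, Finset.sum_filter]

@[simp] lemma weight_empty (x : F → ℝ) : weight x ∅ = 0 := by simp [weight]

lemma weight_univ (x : F → ℝ) : weight x Set.univ = ∑ f, x f := by simp [weight]

@[simp] lemma weight_singleton (x : F → ℝ) (f : F) : weight x {f} = x f := by
  classical
  simp [weight, Set.indicator_apply]

lemma weight_union_add_inter (x : F → ℝ) (A B : Set F) :
    weight x (A ∪ B) + weight x (A ∩ B) = weight x A + weight x B := by
  simp only [weight, ← Finset.sum_add_distrib]
  exact Finset.sum_congr rfl fun f _ => congrFun (Set.indicator_union_add_inter x A B) f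

lemma weight_union (x : F → ℝ) {A B : Set F} (h : Disjoint A B) :
    weight x (A ∪ B) = weight x A + weight x B := by
  rw [← weight_union_add_inter, h.inter_eq, weight_empty, add_zero]

lemma weight_sdiff (x : F → ℝ) {A B : Set F} (h : B ⊆ A) :
    weight x (A \ B) = weight x A - weight x B := by
  rw [eq_sub_iff_add_eq, ← weight_union x Set.disjoint_sdiff_left, Set.sdiff_union_of_subset h]

lemma weight_inter_add_sdiff (x : F → ℝ) (A B : Set F) :
    weight x (A ∩ B) + weight x (A \ B) = weight x A := by
  rw [← weight_union x (Set.disjoint_sdiff_right.mono_left Set.inter_subset_right),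
    Set.inter_union_sdiff]

lemma weight_mono {x : F → ℝ} (hx : ∀ f, 0 ≤ x f) {A B : Set F} (h : A ⊆ B) :
    weight x A ≤ weight x B :=
  Finset.sum_le_sum fun _ _ => Set.indicator_le_indicator_of_subset h hx _

lemma weight_nonneg {x : F → ℝ} (hx : ∀ f, 0 ≤ x f) (A : Set F) : 0 ≤ weight x A :=
  weight_empty x ▸ weight_mono hx (Set.empty_subset A)

lemma le_weight {x : F → ℝ} (hx : ∀ f, 0 ≤ x f) {A : Set F} {f : F} (hf : f ∈ A) :
    x f ≤ weight x A := by
  simpa using weight_mono hx (Set.singleton_subset_iff.2 hf)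

lemma weight_pos {x : F → ℝ} (hx : ∀ f, 0 < x f) {A : Set F} (h : A.Nonempty) :
    0 < weight x A :=
  (hx h.some).trans_le (le_weight (fun f => (hx f).le) h.some_mem)

lemma weight_one (A : Set F) : weight (fun _ => 1) A = A.ncard := by
  classical
  rw [weight_eq_sum, Finset.sum_const, nsmul_eq_mul, mul_one, Set.ncard_eq_toFinset_card']
  congr 2
  ext; simp

lemma weight_one_sub (x : F → ℝ) (A : Set F) :
    weight (fun f => 1 - x f) A = A.ncard - weight x A := by
  rw [← weight_one, weight, weight, weight, ← Finset.sum_sub_distrib]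
  refine Finset.sum_congr rfl fun f _ => ?_
  by_cases h : f ∈ A <;> simp [h]

lemma weight_add (x y : F → ℝ) (A : Set F) :
    weight (fun f => x f + y f) A = weight x A + weight y A := by
  simp only [weight, ← Finset.sum_add_distrib]
  exact Finset.sum_congr rfl fun f _ => congrFun (Set.indicator_add A x y) f

lemma weight_mul (c : ℝ) (x : F → ℝ) (A : Set F) :
    weight (fun f => c * x f) A = c * weight x A := by
  simp only [weight, Finset.mul_sum]
  refine Finset.sum_congr rfl fun f _ => ?_
  by_cases h : f ∈ A <;> simp [h]

open Classical in
/-- Double counting of the incidences between elements and members of a family of sets. -/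
lemma sum_weight {ι : Type*} (s : Finset ι) (x : F → ℝ) (A : ι → Set F) :
    ∑ i ∈ s, weight x (A i) = ∑ f, x f * ({i ∈ s | f ∈ A i}.card : ℝ) := by
  simp only [weight]
  rw [Finset.sum_comm]
  refine Finset.sum_congr rfl fun f _ => ?_
  simp [Set.indicator_apply, ← Finset.sum_filter, mul_comm]

lemma weight_eq_sum_ite (x : F → ℝ) (A : Set F) [DecidablePred (· ∈ A)] :
    weight x A = ∑ f, x f * (if f ∈ A then 1 else 0) := by
  refine Finset.sum_congr rfl fun f _ => ?_
  by_cases h : f ∈ A <;> simp [h]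

lemma sum_weight_le_of_disjoint {ι : Type*} (s : Finset ι) {x : F → ℝ} (hx : ∀ f, 0 ≤ x f)
    (A : ι → Set F) (B : Set F) (hAB : ∀ i ∈ s, A i ⊆ B)
    (h : ∀ i ∈ s, ∀ j ∈ s, ∀ f, f ∈ A i → f ∈ A j → i = j) :
    ∑ i ∈ s, weight x (A i) ≤ weight x B := by
  classical
  rw [sum_weight, weight_eq_sum_ite]
  refine Finset.sum_le_sum fun f _ => mul_le_mul_of_nonneg_left ?_ (hx f)
  split_ifs with hf
  · have : {i ∈ s | f ∈ A i}.card ≤ 1 := by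
      rw [Finset.card_le_one]
      intro i hi j hj
      rw [Finset.mem_filter] at hi hj
      exact h i hi.1 j hj.1 f hi.2 hj.2
    exact_mod_cast this
  · rw [Finset.filter_false_of_mem fun i hi hfi => hf (hAB i hi hfi)]
    simp

end Weight

/-! ### Rings of sets, their atoms, and uncrossing -/

section Pieces

variable {F : Type*}

/-- The elements that belong to the same members of the family `T` as `e`. -/
def piece (T : Set (Set F)) (e : F) : Set F := {f | ∀ S ∈ T, e ∈ S ↔ f ∈ S}

lemma mem_piece_self (T : Set (Set F)) (e : F) : e ∈ piece T e := fun _ _ => Iff.rfl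

lemma mem_piece_iff {T : Set (Set F)} {e f : F} : f ∈ piece T e ↔ piece T f = piece T e := by
  constructor
  · intro h
    ext g
    exact forall₂_congr fun S hS => by rw [h S hS]
  · intro h
    rw [← h]
    exact mem_piece_self T f

lemma piece_subset {T : Set (Set F)} {S : Set F} (hS : S ∈ T) {e : F} (he : e ∈ S) :
    piece T e ⊆ S := fun _ hf => (hf S hS).1 he

lemma piece_subset_sUnion {T : Set (Set F)} {e : F} (he : e ∈ ⋃₀ T) : piece T e ⊆ ⋃₀ T := by
  obtain ⟨S, hS, heS⟩ := he
  exact (piece_subset hS heS).trans (Set.subset_sUnion_of_mem hS)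

variable [Fintype F]

open Classical in
/-- The common refinement of the members of `T`, as a partition of their union. -/
noncomputable def pieces (T : Set (Set F)) : Finset (Set F) :=
  (Finset.univ.filter (· ∈ ⋃₀ T)).image (piece T)

lemma mem_pieces {T : Set (Set F)} {P : Set F} :
    P ∈ pieces T ↔ ∃ e ∈ ⋃₀ T, piece T e = P := by
  simp [pieces]

lemma piece_mem_pieces {T : Set (Set F)} {e : F} (he : e ∈ ⋃₀ T) : piece T e ∈ pieces T :=
  mem_pieces.2 ⟨e, he, rfl⟩

lemma nonempty_of_mem_pieces {T : Set (Set F)} {P : Set F} (hP : P ∈ pieces T) : P.Nonempty := by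
  obtain ⟨e, -, rfl⟩ := mem_pieces.1 hP
  exact ⟨e, mem_piece_self T e⟩

-- `S` is any union of pieces, not only a member of `T`, so that `⋃₀ T` is covered as well.
open Classical in
lemma weight_eq_sum_pieces (T : Set (Set F)) (d : F → ℝ) {S : Set F} (hST : S ⊆ ⋃₀ T)
    (hS : ∀ e ∈ S, piece T e ⊆ S) : weight d S = ∑ P ∈ pieces T with P ⊆ S, weight d P := by
  rw [weight_eq_sum, ← Finset.sum_fiberwise_of_maps_to (g := piece T)
    (t := {P ∈ pieces T | P ⊆ S})]
  · refine Finset.sum_congr rfl fun P hP => ?_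
    rw [Finset.mem_filter] at hP
    obtain ⟨e, -, rfl⟩ := mem_pieces.1 hP.1
    rw [weight_eq_sum]
    refine Finset.sum_congr ?_ fun _ _ => rfl
    ext f
    simp only [Finset.mem_filter, Finset.mem_univ, true_and, mem_piece_iff]
    exact ⟨fun h => h.2, fun h => ⟨hP.2 (mem_piece_iff.2 h), h⟩⟩
  · intro f hf
    simp only [Finset.mem_filter, Finset.mem_univ, true_and] at hf ⊢
    exact ⟨piece_mem_pieces (hST hf), hS f hf⟩

lemma weight_sUnion_eq_sum_pieces (T : Set (Set F)) (d : F → ℝ) :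
    weight d (⋃₀ T) = ∑ P ∈ pieces T, weight d P := by
  classical
  rw [weight_eq_sum_pieces T d subset_rfl fun e he => piece_subset_sUnion he,
    Finset.filter_true_of_mem]
  intro P hP
  obtain ⟨e, he, rfl⟩ := mem_pieces.1 hP
  exact piece_subset_sUnion he

lemma weight_eq_zero_of_pieces {T : Set (Set F)} {d : F → ℝ} (h : ∀ P ∈ pieces T, weight d P = 0)
    {S : Set F} (hS : S ∈ T) : weight d S = 0 := by
  classical
  rw [weight_eq_sum_pieces T d (Set.subset_sUnion_of_mem hS) fun e he => piece_subset hS he]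
  exact Finset.sum_eq_zero fun P hP => h P (Finset.mem_filter.1 hP).1

/-- A family of sets that contains the empty set and is closed under unions and intersections. -/
structure IsRing (T : Set (Set F)) : Prop where
  empty_mem : ∅ ∈ T
  union_mem : ∀ A ∈ T, ∀ B ∈ T, A ∪ B ∈ T
  inter_mem : ∀ A ∈ T, ∀ B ∈ T, A ∩ B ∈ T

lemma IsRing.sUnion_mem {T : Set (Set F)} (hT : IsRing T) {U : Set (Set F)} (hU : U ⊆ T) :
    ⋃₀ U ∈ T := by
  induction U, U.toFinite using Set.Finite.induction_on with
  | empty => simpa using hT.empty_mem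
  | insert _ _ ih =>
    rw [Set.sUnion_insert]
    exact hT.union_mem _ (hU (Set.mem_insert _ _)) _ (ih ((Set.subset_insert _ _).trans hU))

/-- The set `A` handles the empty intersection, since `T` need not contain the whole ground set. -/
lemma IsRing.inter_sInter_mem {T : Set (Set F)} (hT : IsRing T) {A : Set F} (hA : A ∈ T)
    {U : Set (Set F)} (hU : U ⊆ T) : A ∩ ⋂₀ U ∈ T := by
  induction U, U.toFinite using Set.Finite.induction_on with
  | empty => simpa using hA
  | insert _ _ ih =>
    rw [Set.sInter_insert, Set.inter_left_comm]
    exact hT.inter_mem _ (hU (Set.mem_insert _ _)) _ (ih ((Set.subset_insert _ _).trans hU))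

lemma IsRing.exists_minimal {T : Set (Set F)} (hT : IsRing T) {e : F} (he : e ∈ ⋃₀ T) :
    ∃ J ∈ T, e ∈ J ∧ ∀ S ∈ T, e ∈ S → J ⊆ S := by
  obtain ⟨A, hA, heA⟩ := he
  refine ⟨A ∩ ⋂₀ {S ∈ T | e ∈ S}, hT.inter_sInter_mem hA fun S hS => hS.1,
    ⟨heA, fun S hS => hS.2⟩, fun S hS heS => ?_⟩
  exact Set.inter_subset_right.trans (Set.sInter_subset_of_mem ⟨hS, heS⟩)

/-- For the piece of `e`, take `J` as the least member containing `e` and `K` as the part of `J`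
covered by members that avoid `e`. -/
lemma IsRing.exists_piece_eq {T : Set (Set F)} (hT : IsRing T) {P : Set F} (hP : P ∈ pieces T) :
    ∃ J ∈ T, ∃ K ∈ T, K ⊆ J ∧ P = J \ K := by
  obtain ⟨e, he, rfl⟩ := mem_pieces.1 hP
  obtain ⟨J, hJ, heJ, hmin⟩ := hT.exists_minimal he
  refine ⟨J, hJ, J ∩ ⋃₀ {S ∈ T | e ∉ S},
    hT.inter_mem _ hJ _ (hT.sUnion_mem fun S hS => hS.1), Set.inter_subset_left, ?_⟩
  ext f
  constructor
  · intro hf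
    exact ⟨(hf J hJ).1 heJ, fun ⟨_, S, hS, hfS⟩ => hS.2 ((hf S hS.1).2 hfS)⟩
  · rintro ⟨hfJ, hf⟩ S hS
    refine ⟨fun h => hmin S hS h hfJ, fun h => ?_⟩
    by_contra heS
    exact hf ⟨hfJ, S, ⟨hS, heS⟩, h⟩

lemma IsRing.exists_int_weight {T : Set (Set F)} (hT : IsRing T) {x : F → ℝ}
    (hx : ∀ S ∈ T, ∃ n : ℤ, weight x S = n) {P : Set F} (hP : P ∈ pieces T) :
    ∃ n : ℤ, weight x P = n := by
  obtain ⟨J, hJ, K, hK, hKJ, rfl⟩ := hT.exists_piece_eq hP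
  obtain ⟨a, ha⟩ := hx J hJ
  obtain ⟨b, hb⟩ := hx K hK
  exact ⟨a - b, by rw [weight_sdiff x hKJ, ha, hb]; push_cast; ring⟩

lemma IsRing.one_le_weight {T : Set (Set F)} (hT : IsRing T) {x : F → ℝ} (hpos : ∀ f, 0 < x f)
    (hx : ∀ S ∈ T, ∃ n : ℤ, weight x S = n) {P : Set F} (hP : P ∈ pieces T) :
    1 ≤ weight x P := by
  obtain ⟨n, hn⟩ := hT.exists_int_weight hx hP
  have := weight_pos hpos (nonempty_of_mem_pieces hP)
  rw [hn] at this ⊢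
  exact_mod_cast this

/-- The pieces partition the union and each weighs at least 1. This is applied to `1 - x` as well as
to `x`. -/
lemma IsRing.card_pieces_le {T : Set (Set F)} (hT : IsRing T) {x : F → ℝ} (hpos : ∀ f, 0 < x f)
    (hx : ∀ S ∈ T, ∃ n : ℤ, weight x S = n) : ((pieces T).card : ℝ) ≤ weight x (⋃₀ T) := by
  rw [weight_sUnion_eq_sum_pieces, Finset.card_eq_sum_ones, Nat.cast_sum]
  exact Finset.sum_le_sum fun P hP => by simpa using hT.one_le_weight hpos hx hP

/-- Uncrossing: weight is modular and `r` submodular, so two tight sets leave no slack at their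
union and intersection. -/
lemma isRing_tight {x : F → ℝ} (r : Set F → ℝ) (E : Set F) (h0 : r ∅ = 0)
    (hsub : ∀ A B, r (A ∪ B) + r (A ∩ B) ≤ r A + r B) (hle : ∀ S ⊆ E, weight x S ≤ r S) :
    IsRing {S | S ⊆ E ∧ weight x S = r S} := by
  have key : ∀ A B : Set F, A ⊆ E → B ⊆ E → weight x A = r A → weight x B = r B →
      weight x (A ∪ B) = r (A ∪ B) ∧ weight x (A ∩ B) = r (A ∩ B) := by
    intro A B hA hB hA' hB'
    have h1 := hle _ (Set.union_subset hA hB)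
    have h2 := hle _ (Set.inter_subset_left.trans hA : A ∩ B ⊆ E)
    have h3 := hsub A B
    have h4 := weight_union_add_inter x A B
    constructor <;> linarith
  refine ⟨⟨Set.empty_subset _, by simp [h0]⟩, fun A hA B hB => ?_, fun A hA B hB => ?_⟩
  · exact ⟨Set.union_subset hA.1 hB.1, (key A B hA.1 hB.1 hA.2 hB.2).1⟩
  · exact ⟨Set.inter_subset_left.trans hA.1, (key A B hA.1 hB.1 hA.2 hB.2).2⟩

end Pieces

/-- The weights of the sets in `I` give an injective linear map from ℝ^F to ℝ^I. -/
lemma card_le_of_weight_injective {F : Type*} [Fintype F] (I : Finset (Set F))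
    (h : ∀ d : F → ℝ, (∀ P ∈ I, weight d P = 0) → d = 0) : Fintype.card F ≤ I.card := by
  let φ : (F → ℝ) →ₗ[ℝ] (I → ℝ) :=
    { toFun := fun d P => weight d P
      map_add' := fun d e => funext fun P => weight_add d e P
      map_smul' := fun c d => funext fun P => weight_mul c d P }
  have hφ : Function.Injective φ := by
    rw [← LinearMap.ker_eq_bot, LinearMap.ker_eq_bot']
    exact fun d hd => h d fun P hP => congrFun hd ⟨P, hP⟩
  simpa using LinearMap.finrank_le_finrank_of_injective hφ

/-! ### The graphic matroid as the linear matroid of signed incidence vectors -/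

section GraphicRank

variable {W F : Type*} [Fintype W] [DecidableEq W]

/-- The signed incidence vector of an edge with ends `a f` and `b f`. -/
def incidenceVector (a b : F → W) (f : F) : W → ℝ := Pi.single (a f) 1 - Pi.single (b f) 1

/-- The rank function of the graphic matroid of the multigraph in which `f` joins `a f` and
`b f`. -/
noncomputable def graphicRank (a b : F → W) (S : Set F) : ℕ :=
  Module.finrank ℝ (Submodule.span ℝ (incidenceVector a b '' S))

/-- The edges with both ends in `L`. -/
def edgesWithin (a b : F → W) (L : Set W) : Set F := {f | a f ∈ L ∧ b f ∈ L}

variable (a b : F → W)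

lemma graphicRank_empty : graphicRank a b ∅ = 0 := by simp [graphicRank]

lemma graphicRank_union_add_inter_le (A B : Set F) :
    graphicRank a b (A ∪ B) + graphicRank a b (A ∩ B) ≤ graphicRank a b A + graphicRank a b B := by
  unfold graphicRank
  rw [← Submodule.finrank_sup_add_finrank_inf_eq (Submodule.span ℝ (incidenceVector a b '' A)),
    Set.image_union, Submodule.span_union]
  exact Nat.add_le_add_left (Submodule.finrank_mono (le_inf
    (Submodule.span_mono (Set.image_mono Set.inter_subset_left))
    (Submodule.span_mono (Set.image_mono Set.inter_subset_right)))) _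

/-- With a root `u` in `L`, all incidence vectors lie in the span of the |L| - 1 differences of unit
vectors at `v` and `u`. -/
lemma graphicRank_edgesWithin_add_one_le {L : Set W} (hL : L.Nonempty) :
    graphicRank a b (edgesWithin a b L) + 1 ≤ L.ncard := by
  obtain ⟨u, hu⟩ := hL
  let g : W → W → ℝ := fun v => Pi.single v 1 - Pi.single u 1
  have hg : ∀ v ∈ L, g v ∈ Submodule.span ℝ (g '' (L \ {u})) := by
    intro v hv
    by_cases hvu : v = u
    · simp [g, hvu]
    · exact Submodule.subset_span ⟨v, ⟨hv, hvu⟩, rfl⟩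
  have hle : Submodule.span ℝ (incidenceVector a b '' edgesWithin a b L) ≤
      Submodule.span ℝ (g '' (L \ {u})) := by
    rw [Submodule.span_le]
    rintro _ ⟨f, hf, rfl⟩
    have : incidenceVector a b f = g (a f) - g (b f) := by simp [incidenceVector, g]
    rw [this]
    exact sub_mem (hg _ hf.1) (hg _ hf.2)
  have h1 := Submodule.finrank_mono hle
  have h2 : Module.finrank ℝ (Submodule.span ℝ (g '' (L \ {u}))) ≤ (L \ {u}).ncard := by
    classical
    refine (finrank_span_le_card (R := ℝ) (g '' (L \ {u}))).trans ?_
    rw [← Set.ncard_eq_toFinset_card']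
    exact Set.ncard_image_le
  have h3 := Set.ncard_sdiff_singleton_add_one hu L.toFinite
  unfold graphicRank
  omega

/-- The coordinate `v` is a functional that vanishes on the span of the other edges but not on `e`.
-/
lemma graphicRank_sdiff_singleton_add_one_le {S : Set F} {e : F} (he : e ∈ S) {v : W}
    (hv : incidenceVector a b e v ≠ 0)
    (hS : ∀ f ∈ S, f ≠ e → incidenceVector a b f v = 0) :
    graphicRank a b (S \ {e}) + 1 ≤ graphicRank a b S := by
  apply Submodule.finrank_lt_finrank_of_lt
  refine lt_of_le_of_ne (Submodule.span_mono (Set.image_mono Set.sdiff_subset)) fun h => ?_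
  have h1 : incidenceVector a b e ∈ Submodule.span ℝ (incidenceVector a b '' (S \ {e})) :=
    h ▸ Submodule.subset_span ⟨e, he, rfl⟩
  have h2 : Submodule.span ℝ (incidenceVector a b '' (S \ {e})) ≤
      LinearMap.ker (LinearMap.proj v : (W → ℝ) →ₗ[ℝ] ℝ) := by
    rw [Submodule.span_le]
    rintro _ ⟨f, hf, rfl⟩
    exact hS f hf.1 hf.2
  exact hv (h2 h1)

variable [Fintype F]

lemma weight_le_sum_weight {ι : Type*} (s : Finset ι) {x : F → ℝ} (hx : ∀ f, 0 ≤ x f)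
    (A : ι → Set F) (S : Set F) (h : ∀ f ∈ S, ∃ i ∈ s, f ∈ A i) :
    weight x S ≤ ∑ i ∈ s, weight x (A i) := by
  classical
  rw [sum_weight, weight_eq_sum_ite]
  refine Finset.sum_le_sum fun f _ => mul_le_mul_of_nonneg_left ?_ (hx f)
  split_ifs with hf
  · obtain ⟨i, hi, hfi⟩ := h f hf
    have : 0 < {i ∈ s | f ∈ A i}.card := Finset.card_pos.2 ⟨i, Finset.mem_filter.2 ⟨hi, hfi⟩⟩
    exact_mod_cast this
  · positivity

/-- A point satisfying the spanning tree constraints satisfies all rank constraints of the graphic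
matroid. -/
lemma weight_le_graphicRank {x : F → ℝ} (hx : ∀ f, 0 ≤ x f)
    (hL : ∀ L : Set W, L.Nonempty → weight x (edgesWithin a b L) ≤ (L.ncard : ℝ) - 1)
    (S : Set F) : weight x S ≤ graphicRank a b S := by
  classical
  set V := Submodule.span ℝ (incidenceVector a b '' S) with hV
  let e : W → W → ℝ := fun w => Pi.single w 1
  -- The classes play the role of the components of `S`: every edge of `S` stays within one class,
  -- so summing the class constraints bounds x(S) by |W| minus the number of classes.
  let s : Setoid W :=
    { r := fun u v => e u - e v ∈ V
      iseqv :=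
        ⟨fun u => by simp, fun {u v} h => by simpa using neg_mem h,
          fun {u v w} h h' => by simpa using add_mem h h'⟩ }
  have h1 : weight x S ≤
      ∑ c : Quotient s, weight x (edgesWithin a b {w | (Quotient.mk s w) = c}) := by
    refine weight_le_sum_weight _ hx _ S fun f hf => ⟨Quotient.mk s (a f), Finset.mem_univ _, rfl, ?_⟩
    exact Quotient.sound (s := s) (show e (b f) - e (a f) ∈ V by
      simpa [e, incidenceVector] using neg_mem (Submodule.subset_span ⟨f, hf, rfl⟩ :
        incidenceVector a b f ∈ V))
  have h2 : ∑ c : Quotient s, weight x (edgesWithin a b {w | (Quotient.mk s w) = c}) ≤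
      ∑ c : Quotient s, (({w | (Quotient.mk s w) = c}.ncard : ℝ) - 1) :=
    Finset.sum_le_sum fun c _ => hL _ ⟨c.out, c.out_eq⟩
  have h3 : ∑ c : Quotient s, ({w | (Quotient.mk s w) = c}.ncard : ℝ) = Fintype.card W := by
    rw [← Nat.cast_sum, ← Finset.card_univ,
      Finset.card_eq_sum_card_fiberwise (f := Quotient.mk s) (t := Finset.univ) (by simp)]
    congr 1
    refine Finset.sum_congr rfl fun c _ => ?_
    rw [Set.ncard_eq_toFinset_card']
    congr 1
    ext; simp
  have h4 : Fintype.card W ≤ Module.finrank ℝ V + Fintype.card (Quotient s) := by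
    -- `V` and one unit vector per class span everything, so |W| minus the number of classes is at
    -- most dim `V`.
    let T := Submodule.span ℝ (Set.range fun c : Quotient s => e c.out)
    have htop : V ⊔ T = ⊤ := by
      rw [eq_top_iff, ← (Pi.basisFun ℝ W).span_eq, Submodule.span_le]
      rintro _ ⟨w, rfl⟩
      have hw : e w - e (Quotient.mk s w).out ∈ V :=
        Quotient.exact (s := s) (Quotient.out_eq (Quotient.mk s w)).symm
      have := Submodule.add_mem_sup hw
        (Submodule.subset_span ⟨Quotient.mk s w, rfl⟩ : e (Quotient.mk s w).out ∈ T)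
      simpa [e] using this
    calc Fintype.card W = Module.finrank ℝ (⊤ : Submodule ℝ (W → ℝ)) := by simp
      _ ≤ Module.finrank ℝ V + Module.finrank ℝ T :=
        htop ▸ Submodule.finrank_add_le_finrank_add_finrank V T
      _ ≤ _ := by gcongr; exact finrank_range_le_card _
  have h5 : (Fintype.card W : ℝ) ≤ Module.finrank ℝ V + Fintype.card (Quotient s) := by
    exact_mod_cast h4
  rw [Finset.sum_sub_distrib, h3] at h2
  simp only [Finset.sum_const, Finset.card_univ, nsmul_eq_mul, mul_one] at h2
  unfold graphicRank
  linarith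

end GraphicRank

/-! ### Perturbing extreme points, and tight sets of the degree constraints -/

section Tight

variable {W F : Type*} [Fintype F]

-- A slack constraint survives a small move, and a tight one does not change along `d`.
open Filter Topology in
lemma eventually_weight_le {x d : F → ℝ} {S : Set F} {c : ℝ} (h : weight x S ≤ c)
    (hd : weight x S = c → weight d S = 0) :
    ∀ᶠ t in 𝓝 (0 : ℝ), weight (fun f => x f + t * d f) S ≤ c := by
  simp only [weight_add, weight_mul]
  rcases h.lt_or_eq with h | h
  · have : Tendsto (fun t : ℝ => weight x S + t * weight d S) (𝓝 0) (𝓝 (weight x S + 0 * weight d S)) :=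
      Continuous.tendsto (by fun_prop) 0
    rw [zero_mul, add_zero] at this
    exact (this.eventually (gt_mem_nhds h)).mono fun t ht => ht.le
  · simp [hd h, h]

open Filter Topology in
/-- A direction that vanishes on all tight constraints at a positive basic solution is zero. -/
lemma IsBasicSolution.eq_zero [Finite W] {H : Graph W F} {N : W → Matroid F}
    {fixed : Set (Set W)} {x : F → ℝ} (hx : IsBasicSolution H N fixed x) (hpos : ∀ f, 0 < x f)
    {d : F → ℝ} (hE : weight d H.edgeSet = 0)
    (hL : ∀ L : Set W, L.Nonempty → weight x (inducedEdges H L) = (L.ncard : ℝ) - 1 →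
      weight d (inducedEdges H L) = 0)
    (hfixed : ∀ L ∈ fixed, L.Nonempty)
    (hN : ∀ w, ∀ C ⊆ (N w).E, weight x C = (((N w).eRk C).toNat : ℝ) → weight d C = 0) :
    d = 0 := by
  obtain ⟨⟨⟨-, h2, h3⟩, h4, h5⟩, hext⟩ := mem_extremePoints.1 hx
  have hev : ∀ d : F → ℝ, weight d H.edgeSet = 0 →
      (∀ L : Set W, L.Nonempty → weight x (inducedEdges H L) = (L.ncard : ℝ) - 1 →
      weight d (inducedEdges H L) = 0) →
      (∀ w, ∀ C ⊆ (N w).E, weight x C = (((N w).eRk C).toNat : ℝ) → weight d C = 0) →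
      ∀ᶠ t in 𝓝 (0 : ℝ), (fun f => x f + t * d f) ∈ feasibleRegion H N fixed := by
    intro d hE hL hN
    have e1 : ∀ᶠ t in 𝓝 (0 : ℝ), ∀ f, 0 ≤ x f + t * d f := by
      refine eventually_all.2 fun f => ?_
      have : Tendsto (fun t : ℝ => x f + t * d f) (𝓝 0) (𝓝 (x f + 0 * d f)) :=
        Continuous.tendsto (by fun_prop) 0
      rw [zero_mul, add_zero] at this
      exact (this.eventually (lt_mem_nhds (hpos f))).mono fun t ht => ht.le
    have e2 : ∀ᶠ t in 𝓝 (0 : ℝ), ∀ L : Set W, L.Nonempty → L ⊆ H.vertexSet →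
        weight (fun f => x f + t * d f) (inducedEdges H L) ≤ (L.ncard : ℝ) - 1 := by
      refine eventually_all.2 fun L => ?_
      simp only [eventually_imp_distrib_left]
      exact fun hne hLV => eventually_weight_le (h3 L hne hLV) (hL L hne)
    have e3 : ∀ᶠ t in 𝓝 (0 : ℝ), ∀ w, w ∈ H.vertexSet → ∀ C, C ⊆ (N w).E →
        weight (fun f => x f + t * d f) C ≤ (((N w).eRk C).toNat : ℝ) := by
      refine eventually_all.2 fun w => ?_
      simp only [eventually_imp_distrib_left]
      refine fun hw => eventually_all.2 fun C => ?_
      simp only [eventually_imp_distrib_left]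
      exact fun hC => eventually_weight_le ((h4 w hw).2 C hC) (hN w C hC)
    filter_upwards [e1, e2, e3] with t t1 t2 t3
    refine ⟨⟨t1, ?_, t2⟩, fun w hw => ⟨fun f _ => t1 f, t3 w hw⟩, fun L hLf => ?_⟩
    · rw [weight_add, weight_mul, hE, h2]; ring
    · rw [weight_add, weight_mul, hL L (hfixed L hLf) (h5 L hLf), h5 L hLf]; ring
  have p := hev d hE hL hN
  -- The hypotheses are invariant under negating `d`, so `x` is the midpoint of two feasible points.
  have q := hev (fun f => (-1) * d f) (by rw [weight_mul, hE, mul_zero])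
    (fun L hne h => by rw [weight_mul, hL L hne h, mul_zero])
    (fun w C hC h => by rw [weight_mul, hN w C hC h, mul_zero])
  obtain ⟨t, ⟨tp, tq⟩, ht : 0 < t⟩ :=
    (((p.and q).filter_mono nhdsWithin_le_nhds).and
      (self_mem_nhdsWithin : Set.Ioi (0 : ℝ) ∈ 𝓝[>] 0)).exists
  have hseg : x ∈ openSegment ℝ (fun f => x f + t * d f) (fun f => x f + t * (-1 * d f)) := by
    refine ⟨1 / 2, 1 / 2, by norm_num, by norm_num, by norm_num, ?_⟩
    ext f
    simp only [Pi.add_apply, Pi.smul_apply, smul_eq_mul]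
    ring
  have heq := (hext _ tp _ tq hseg).1
  ext f
  have := congrFun heq f
  simpa [ht.ne'] using this

/-- The sets that are tight for `x` in the matroid polytope of `M`. -/
def tightSets (M : Matroid F) (x : F → ℝ) : Set (Set F) :=
  {C | C ⊆ M.E ∧ weight x C = ((M.eRk C).toNat : ℝ)}

lemma eRk_ne_top (M : Matroid F) (C : Set F) : M.eRk C ≠ ⊤ :=
  ne_top_of_le_ne_top (Set.encard_ne_top_iff.2 C.toFinite) (M.eRk_le_encard C)

lemma isRing_tightSets {M : Matroid F} {x : F → ℝ} (hx : x ∈ matroidPolytope M) :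
    IsRing (tightSets M x) := by
  refine isRing_tight (fun C => ((M.eRk C).toNat : ℝ)) M.E (by simp) (fun A B => ?_) hx.2
  have h := M.eRk_submod A B
  rw [← ENat.natCast_toNat (eRk_ne_top M (A ∩ B)), ← ENat.natCast_toNat (eRk_ne_top M (A ∪ B)),
    ← ENat.natCast_toNat (eRk_ne_top M A), ← ENat.natCast_toNat (eRk_ne_top M B)] at h
  have h' : (M.eRk (A ∩ B)).toNat + (M.eRk (A ∪ B)).toNat ≤
    (M.eRk A).toNat + (M.eRk B).toNat := by exact_mod_cast h
  rw [add_comm]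
  exact_mod_cast h'

lemma exists_int_weight_of_mem_tightSets {M : Matroid F} {x : F → ℝ} :
    ∀ S ∈ tightSets M x, ∃ n : ℤ, weight x S = n :=
  fun S hS => ⟨(M.eRk S).toNat, by rw [hS.2]; simp⟩

/-- A free element of value less than one is in no tight set. -/
lemma isContained_of_mem_tightSets {M : Matroid F} {x : F → ℝ} (hx : x ∈ matroidPolytope M)
    {C : Set F} (hC : C ∈ tightSets M x) {f : F} (hf : f ∈ C) (hf1 : x f < 1) :
    IsContained M f := by
  refine ⟨hC.1 hf, fun hfree => ?_⟩
  obtain ⟨I, hI⟩ := M.exists_isBasis (C \ {f}) (Set.sdiff_subset.trans hC.1)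
  have hfI : f ∉ I := fun h => (hI.subset h).2 rfl
  -- A basis of `C \ {f}` stays independent when `f` is added; so removing `f` lowers the rank by 1
  -- but the weight by less than 1.
  have h1 : M.eRk (C \ {f}) + 1 ≤ M.eRk C := by
    rw [← hI.encard_eq_eRk, ← Set.encard_insert_of_notMem hfI]
    exact (hfree.2 I hI.indep).encard_le_eRk_of_subset
      (Set.insert_subset hf (hI.subset.trans Set.sdiff_subset))
  rw [← ENat.natCast_toNat (eRk_ne_top M C), ← ENat.natCast_toNat (eRk_ne_top M (C \ {f}))] at h1
  have h2 : ((M.eRk (C \ {f})).toNat : ℝ) + 1 ≤ (M.eRk C).toNat := by exact_mod_cast h1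
  have h3 := hx.2 (C \ {f}) (Set.sdiff_subset.trans hC.1)
  rw [weight_sdiff x (Set.singleton_subset_iff.2 hf), weight_singleton, hC.2] at h3
  linarith

end Tight

/-! ### Tight sets of the spanning tree polytope -/

section SpanningTree

variable {W F : Type*} [Fintype W] [Fintype F]

/-- The edge sets that are tight for `x` with respect to the rank function of the graphic
matroid. -/
def graphicTightSets [DecidableEq W] (a b : F → W) (x : F → ℝ) : Set (Set F) :=
  {S | S ⊆ Set.univ ∧ weight x S = (graphicRank a b S : ℝ)}

/-- The spanning tree constraints, for the multigraph in which `f` joins `a f` and `b f`. -/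
structure IsSpanningTreePoint (a b : F → W) (x : F → ℝ) : Prop where
  pos : ∀ f, 0 < x f
  lt_one : ∀ f, x f < 1
  weight_univ : weight x Set.univ = (Fintype.card W : ℝ) - 1
  weight_le : ∀ L : Set W, L.Nonempty → weight x (edgesWithin a b L) ≤ (L.ncard : ℝ) - 1

variable {a b : F → W} {x : F → ℝ}

lemma IsSpanningTreePoint.ne (h : IsSpanningTreePoint a b x) (f : F) : a f ≠ b f := by
  intro hf
  have h1 := h.weight_le {a f} (Set.singleton_nonempty _)
  have h2 := le_weight (fun f => (h.pos f).le)
    (show f ∈ edgesWithin a b {a f} from ⟨rfl, hf.symm⟩)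
  have := h.pos f
  simp at h1
  linarith

lemma IsSpanningTreePoint.nonempty (h : IsSpanningTreePoint a b x) : Nonempty W := by
  by_contra hW
  rw [not_nonempty_iff] at hW
  have h1 := h.weight_univ
  have h2 := weight_nonneg (fun f => (h.pos f).le) Set.univ
  simp at h1
  linarith

variable [DecidableEq W]

lemma IsSpanningTreePoint.isRing (h : IsSpanningTreePoint a b x) :
    IsRing (graphicTightSets a b x) :=
  isRing_tight (fun S => (graphicRank a b S : ℝ)) Set.univ (by simp [graphicRank_empty])
    (fun A B => by exact_mod_cast graphicRank_union_add_inter_le a b A B)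
    fun S _ => weight_le_graphicRank a b (fun f => (h.pos f).le) h.weight_le S

omit [Fintype W] in
lemma exists_int_weight_of_mem_graphicTightSets :
    ∀ S ∈ graphicTightSets a b x, ∃ n : ℤ, weight x S = n :=
  fun S hS => ⟨graphicRank a b S, by rw [hS.2]; simp⟩

/-- The chain |L| - 1 = x(F[L]) ≤ rank ≤ |L| - 1 collapses. -/
lemma IsSpanningTreePoint.edgesWithin_mem (h : IsSpanningTreePoint a b x) {L : Set W}
    (hL : L.Nonempty) (hLx : weight x (edgesWithin a b L) = (L.ncard : ℝ) - 1) :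
    edgesWithin a b L ∈ graphicTightSets a b x := by
  refine ⟨Set.subset_univ _, le_antisymm
    (weight_le_graphicRank a b (fun f => (h.pos f).le) h.weight_le _) ?_⟩
  have : (graphicRank a b (edgesWithin a b L) : ℝ) + 1 ≤ L.ncard := by
    exact_mod_cast graphicRank_edgesWithin_add_one_le a b hL
  linarith

lemma IsSpanningTreePoint.univ_mem (h : IsSpanningTreePoint a b x) :
    Set.univ ∈ graphicTightSets a b x := by
  have := h.nonempty
  have huniv : edgesWithin a b Set.univ = Set.univ := by simp [edgesWithin]
  have := h.edgesWithin_mem Set.univ_nonempty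
    (by rw [huniv, h.weight_univ, Set.ncard_univ, Nat.card_eq_fintype_card])
  rwa [huniv] at this

lemma IsSpanningTreePoint.sUnion_eq (h : IsSpanningTreePoint a b x) :
    ⋃₀ graphicTightSets a b x = Set.univ :=
  Set.eq_univ_of_univ_subset (Set.subset_sUnion_of_mem h.univ_mem)

/-- An edge that is the only edge of a tight set at one of its ends has value at least one. -/
lemma IsSpanningTreePoint.exists_ne (h : IsSpanningTreePoint a b x) {S : Set F}
    (hS : S ∈ graphicTightSets a b x) {e : F} (he : e ∈ S) {v : W} (hv : a e = v ∨ b e = v) :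
    ∃ f ∈ S, f ≠ e ∧ (a f = v ∨ b f = v) := by
  by_contra! hcon
  have hne := h.ne e
  -- If `e` is alone at `v`, deleting it lowers the rank by 1 but the weight only by x(e) < 1,
  -- violating a rank constraint.
  have h1 : graphicRank a b (S \ {e}) + 1 ≤ graphicRank a b S := by
    refine graphicRank_sdiff_singleton_add_one_le a b he (v := v) ?_ fun f hf hfe => ?_
    · rcases hv with rfl | rfl
      · simp [incidenceVector, hne]
      · simp [incidenceVector, hne.symm]
    · have := hcon f hf hfe
      simp [incidenceVector, this.1.symm, this.2.symm]
  have h2 : (graphicRank a b (S \ {e}) : ℝ) + 1 ≤ graphicRank a b S := by exact_mod_cast h1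
  have h3 := weight_le_graphicRank a b (fun f => (h.pos f).le) h.weight_le (S \ {e})
  rw [weight_sdiff x (Set.singleton_subset_iff.2 he), weight_singleton, hS.2] at h3
  have := h.lt_one e
  linarith

end SpanningTree

/-! ### Degree sums and nodes of degree two -/

section Counting

variable {W F : Type*} [Fintype W] [Fintype F] {a b : F → W} {x : F → ℝ}

/-- The edges incident to `w`. -/
def edgesAt (a b : F → W) (w : W) : Set F := {f | a f = w ∨ b f = w}

open Classical in
lemma sum_weight_le {ι : Type*} (s : Finset ι) (hx : ∀ f, 0 ≤ x f) (A : ι → Set F) (c : F → ℝ)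
    (hc : ∀ f, ({i ∈ s | f ∈ A i}.card : ℝ) ≤ c f) :
    ∑ i ∈ s, weight x (A i) ≤ ∑ f, x f * c f := by
  rw [sum_weight]
  exact Finset.sum_le_sum fun f _ => mul_le_mul_of_nonneg_left (by convert hc f) (hx f)

omit [Fintype W] [Fintype F] in
open Classical in
lemma card_filter_edgesAt_le_two (s : Finset W) (A : W → Set F) (hA : ∀ w, A w ⊆ edgesAt a b w)
    (f : F) : {w ∈ s | f ∈ A w}.card ≤ 2 := by
  refine (Finset.card_le_card (t := {a f, b f}) fun w hw => ?_).trans Finset.card_le_two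
  rw [Finset.mem_filter] at hw
  rcases hA w hw.2 with h | h <;> simp [← h]

omit [Fintype W] [Fintype F] in
open Classical in
lemma card_filter_edgesAt_le_one (s : Finset W) (A : W → Set F) (hA : ∀ w, A w ⊆ edgesAt a b w)
    (f : F) (h : ¬ ((a f ∈ s ∧ f ∈ A (a f)) ∧ (b f ∈ s ∧ f ∈ A (b f)))) :
    {w ∈ s | f ∈ A w}.card ≤ 1 := by
  rw [Finset.card_le_one]
  intro u hu v hv
  rw [Finset.mem_filter] at hu hv
  rcases hA u hu.2 with rfl | rfl <;> rcases hA v hv.2 with h' | h'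
  · exact h'
  · exact absurd ⟨hu, h'.symm ▸ hv⟩ h
  · exact absurd ⟨h'.symm ▸ hv, hu⟩ h
  · exact h'

-- An edge is counted at most once, except twice when contained at both ends and never when in `E`.
open Classical in
lemma sum_weight_contained_le (hx : ∀ f, 0 ≤ x f) (D : W → Set F)
    (hD : ∀ w, D w ⊆ edgesAt a b w) (E : Set F) (hE : ∀ f ∈ E, ∀ w, f ∉ D w) :
    ∑ w, weight x (D w) ≤
      weight x Set.univ + weight x {f | f ∈ D (a f) ∧ f ∈ D (b f)} - weight x E := by
  refine (sum_weight_le Finset.univ hx D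
    (fun f => 1 + (if f ∈ {f | f ∈ D (a f) ∧ f ∈ D (b f)} then 1 else 0) -
      (if f ∈ E then 1 else 0)) fun f => ?_).trans_eq ?_
  · by_cases hfE : f ∈ E
    · rw [Finset.filter_false_of_mem fun w _ => hE f hfE w]
      simp only [hfE]
      split_ifs <;> simp
    · by_cases hf : f ∈ {f | f ∈ D (a f) ∧ f ∈ D (b f)}
      · have := card_filter_edgesAt_le_two Finset.univ D hD f
        simp only [hf, hfE, if_true, if_false]
        norm_num
        exact_mod_cast this
      · have := card_filter_edgesAt_le_one Finset.univ D hD f fun h => hf ⟨h.1.2, h.2.2⟩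
        simp only [hf, hfE, if_false]
        norm_num
        exact_mod_cast this
  · rw [weight_univ, weight_eq_sum_ite, weight_eq_sum_ite, ← Finset.sum_add_distrib,
      ← Finset.sum_sub_distrib]
    exact Finset.sum_congr rfl fun f _ => by ring

omit [Fintype W] in
open Classical in
lemma sum_weight_edgesAt_inter_le_two_mul (hx : ∀ f, 0 ≤ x f) (s : Finset W) (E : Set F) :
    ∑ w ∈ s, weight x (edgesAt a b w ∩ E) ≤ 2 * weight x E := by
  obtain ⟨A, hA⟩ : ∃ A : W → Set F, ∀ w, edgesAt a b w ∩ E = A w := ⟨_, fun _ => rfl⟩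
  have hA1 : ∀ w, A w ⊆ edgesAt a b w := fun w => hA w ▸ Set.inter_subset_left
  have hA2 : ∀ w, A w ⊆ E := fun w => hA w ▸ Set.inter_subset_right
  simp only [hA]
  refine (sum_weight_le s hx _ (fun f => 2 * (if f ∈ E then 1 else 0)) fun f => ?_).trans_eq ?_
  · split_ifs with hf
    · have := card_filter_edgesAt_le_two s A hA1 f
      norm_num
      exact_mod_cast this
    · rw [Finset.filter_false_of_mem fun w _ h => hf (hA2 w h)]
      simp
  · rw [weight_eq_sum_ite, Finset.mul_sum]
    exact Finset.sum_congr rfl fun f _ => by ring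

-- Only edges with both ends in `s` are counted twice.
omit [Fintype W] in
open Classical in
lemma sum_weight_edgesAt_inter_le (hx : ∀ f, 0 ≤ x f) (s : Finset W) (E P : Set F)
    (hP : ∀ w ∈ s, edgesAt a b w ∩ E ⊆ P) :
    ∑ w ∈ s, weight x (edgesAt a b w ∩ E) ≤
      weight x P + weight x (P ∩ (E ∩ edgesWithin a b (s : Set W))) := by
  obtain ⟨A, hA⟩ : ∃ A : W → Set F, ∀ w, edgesAt a b w ∩ E = A w := ⟨_, fun _ => rfl⟩
  have hA1 : ∀ w, A w ⊆ edgesAt a b w := fun w => hA w ▸ Set.inter_subset_left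
  have hA2 : ∀ w, A w ⊆ E := fun w => hA w ▸ Set.inter_subset_right
  simp only [hA] at hP ⊢
  refine (sum_weight_le s hx _ (fun f => (if f ∈ P then 1 else 0) +
    (if f ∈ P ∩ (E ∩ edgesWithin a b (s : Set W)) then 1 else 0)) fun f => ?_).trans_eq ?_
  · by_cases hfP : f ∈ P
    · by_cases hf : f ∈ P ∩ (E ∩ edgesWithin a b (s : Set W))
      · have := card_filter_edgesAt_le_two s A hA1 f
        simp only [hf, hfP, if_true]
        norm_num
        exact_mod_cast this
      · have := card_filter_edgesAt_le_one s A hA1 f fun h => hf ⟨hfP, hA2 _ h.1.2, h.1.1, h.2.1⟩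
        simp only [hf, hfP, if_true, if_false]
        norm_num
        exact_mod_cast this
    · rw [Finset.filter_false_of_mem fun w hw h => hfP (hP w hw h)]
      simp only [Finset.card_empty, Nat.cast_zero]
      split_ifs <;> simp
  · rw [weight_eq_sum_ite, weight_eq_sum_ite, ← Finset.sum_add_distrib]
    exact Finset.sum_congr rfl fun f _ => by ring

omit [Fintype W] [Fintype F] in
lemma edgesWithin_sdiff_singleton (L : Set W) (v : W) :
    edgesWithin a b (L \ {v}) = edgesWithin a b L \ (edgesAt a b v ∩ edgesWithin a b L) := by
  ext f
  simp only [edgesWithin, edgesAt, Set.mem_ofPred_eq, Set.mem_sdiff, Set.mem_singleton_iff,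
    Set.mem_inter_iff]
  tauto

/-- Compare the tight set `R` with the constraint for `R \ {v}`, which is nonempty as |R| > 1. -/
lemma IsSpanningTreePoint.one_le_weight_edgesAt (h : IsSpanningTreePoint a b x) {R : Finset W}
    (hR : weight x (edgesWithin a b R) = (R.card : ℝ) - 1) (hR1 : 1 < R.card) {v : W}
    (hv : v ∈ R) : 1 ≤ weight x (edgesAt a b v ∩ edgesWithin a b R) := by
  have hne : ((R : Set W) \ {v}).Nonempty := by
    obtain ⟨u, hu, huv⟩ := Finset.exists_mem_ne hR1 v
    exact ⟨u, hu, huv⟩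
  have h1 := h.weight_le _ hne
  have h2 := Set.ncard_sdiff_singleton_add_one (Finset.mem_coe.2 hv) R.finite_toSet
  rw [Set.ncard_coe_finset] at h2
  have h3 : (((R : Set W) \ {v}).ncard : ℝ) + 1 = R.card := by exact_mod_cast h2
  rw [edgesWithin_sdiff_singleton, weight_sdiff x Set.inter_subset_right, hR] at h1
  linarith

variable [DecidableEq W]

/-- Two edges that are the only edges of a tight set at some node are in the same piece. -/
lemma IsSpanningTreePoint.subset_piece (h : IsSpanningTreePoint a b x) {E : Set F}
    (hE : E ∈ graphicTightSets a b x) {v : W} (h2 : (edgesAt a b v ∩ E).ncard = 2) :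
    ∃ P ∈ pieces (graphicTightSets a b x), edgesAt a b v ∩ E ⊆ P := by
  obtain ⟨e, f, hef, hs⟩ := Set.ncard_eq_two.1 h2
  have key : ∀ e f, edgesAt a b v ∩ E = {e, f} → ∀ S ∈ graphicTightSets a b x, e ∈ S → f ∈ S := by
    intro e f hs S hS he
    have he' : e ∈ edgesAt a b v ∩ E := by simp [hs]
    -- The set `S ∩ E` is tight, so it has a second edge at `v`; in `E` only `f` is available.
    obtain ⟨g, hg, hge, hgv⟩ := h.exists_ne (h.isRing.inter_mem _ hS _ hE) ⟨he, he'.2⟩ he'.1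
    have : g ∈ edgesAt a b v ∩ E := ⟨hgv, hg.2⟩
    rw [hs] at this
    rcases this with rfl | rfl
    · exact absurd rfl hge
    · exact hg.1
  refine ⟨piece _ e, piece_mem_pieces (by rw [h.sUnion_eq]; trivial), ?_⟩
  rw [hs]
  rintro g (rfl | rfl)
  · exact mem_piece_self _ _
  · exact fun S hS => ⟨key e g hs S hS, key g e (by rw [hs, Set.pair_comm]) S hS⟩

lemma weight_inter_pieces_le (hx : ∀ f, 0 ≤ x f) (T : Set (Set F)) (E : Set F) :
    ∑ P ∈ pieces T, weight x (P ∩ E) ≤ weight x E := by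
  refine sum_weight_le_of_disjoint _ hx _ _ (fun P _ => Set.inter_subset_right) ?_
  intro P hP P' hP' f hf hf'
  obtain ⟨e, -, rfl⟩ := mem_pieces.1 hP
  obtain ⟨e', -, rfl⟩ := mem_pieces.1 hP'
  rw [← mem_piece_iff.1 hf.1, ← mem_piece_iff.1 hf'.1]

/-- The number of nodes of degree two in a tight edge set `E` is bounded in terms of the slack
`x(F) - |pieces|` and of the edges of `E` between those nodes. -/
lemma IsSpanningTreePoint.card_degree_two_le (h : IsSpanningTreePoint a b x) {E : Set F}
    (hE : E ∈ graphicTightSets a b x) (s : Finset W)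
    (h2 : ∀ v ∈ s, (edgesAt a b v ∩ E).ncard = 2)
    (h1 : ∀ v ∈ s, 1 < weight x (edgesAt a b v ∩ E)) :
    (s.card : ℝ) ≤ 2 * (weight x Set.univ - (pieces (graphicTightSets a b x)).card) +
      weight x (E ∩ edgesWithin a b (s : Set W)) := by
  classical
  have hx : ∀ f, 0 ≤ x f := fun f => (h.pos f).le
  choose! g hg hgs using fun v hv => h.subset_piece hE (h2 v hv)
  have hP : ∀ P ∈ pieces (graphicTightSets a b x), (({v ∈ s | g v = P}.card : ℕ) : ℝ) ≤
      2 * (weight x P - 1) + weight x (P ∩ (E ∩ edgesWithin a b (s : Set W))) := by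
    intro P hP
    have hP1 := h.isRing.one_le_weight h.pos exists_int_weight_of_mem_graphicTightSets hP
    have hnn := weight_nonneg hx (P ∩ (E ∩ edgesWithin a b (s : Set W)))
    rcases ({v ∈ s | g v = P} : Finset W).eq_empty_or_nonempty with hs | ⟨v, hv⟩
    · rw [hs, Finset.card_empty, Nat.cast_zero]
      linarith
    · rw [Finset.mem_filter] at hv
      -- The integer x(P) exceeds 1. From x(P) ≥ 2 it follows that x(P) ≤ 2(x(P) - 1), which turns
      -- the degree sum into slack of the piece.
      have hP2 : 2 ≤ weight x P := by
        have hlt := (h1 v hv.1).trans_le (weight_mono hx (hv.2 ▸ hgs v hv.1))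
        obtain ⟨n, hn⟩ :=
          h.isRing.exists_int_weight exists_int_weight_of_mem_graphicTightSets hP
        rw [hn] at hlt ⊢
        have : 1 < n := by exact_mod_cast hlt
        exact_mod_cast this
      have hsum : (({v ∈ s | g v = P}.card : ℕ) : ℝ) ≤
          ∑ v ∈ s with g v = P, weight x (edgesAt a b v ∩ E) := by
        rw [Finset.card_eq_sum_ones, Nat.cast_sum]
        exact Finset.sum_le_sum fun v hv => by
          simpa using (h1 v (Finset.mem_filter.1 hv).1).le
      have hle := sum_weight_edgesAt_inter_le hx {v ∈ s | g v = P} E P fun v hv => by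
        rw [Finset.mem_filter] at hv
        exact hv.2 ▸ hgs v hv.1
      have hmono : weight x (P ∩ (E ∩ edgesWithin a b
          (({v ∈ s | g v = P} : Finset W) : Set W))) ≤
          weight x (P ∩ (E ∩ edgesWithin a b (s : Set W))) :=
        weight_mono hx fun f hf => ⟨hf.1, hf.2.1,
          (Finset.mem_filter.1 hf.2.2.1).1, (Finset.mem_filter.1 hf.2.2.2).1⟩
      linarith
  calc (s.card : ℝ) = ∑ P ∈ pieces (graphicTightSets a b x),
        (({v ∈ s | g v = P}.card : ℕ) : ℝ) := by
        rw [Finset.card_eq_sum_card_fiberwise hg, Nat.cast_sum]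
    _ ≤ ∑ P ∈ pieces (graphicTightSets a b x), (2 * (weight x P - 1) +
        weight x (P ∩ (E ∩ edgesWithin a b (s : Set W)))) := Finset.sum_le_sum hP
    _ ≤ _ := by
        rw [Finset.sum_add_distrib, ← Finset.mul_sum, Finset.sum_sub_distrib,
          ← weight_sUnion_eq_sum_pieces, h.sUnion_eq]
        have := weight_inter_pieces_le hx (graphicTightSets a b x)
          (E ∩ edgesWithin a b (s : Set W))
        simp only [Finset.sum_const, nsmul_eq_mul, mul_one]
        linarith

end Counting

/-! ### The counting argument -/

section Contradiction

variable {W F : Type*} [Fintype W] [Fintype F] {a b : F → W} {x : F → ℝ}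

/-- The bound is weakened from |s| - 1 to |s| to allow empty `s`. -/
lemma IsSpanningTreePoint.weight_inter_le_card (h : IsSpanningTreePoint a b x) (E : Set F)
    (s : Finset W) (hs : ∀ f ∈ E, a f ∈ s ∧ b f ∈ s) : weight x E ≤ s.card := by
  have hx : ∀ f, 0 ≤ x f := fun f => (h.pos f).le
  rcases s.eq_empty_or_nonempty with rfl | hne
  · have : E = ∅ := Set.eq_empty_of_forall_notMem fun f hf => by simpa using hs f hf
    simp [this]
  · have h1 := h.weight_le (s : Set W) hne
    rw [Set.ncard_coe_finset] at h1
    have h2 : weight x E ≤ weight x (edgesWithin a b (s : Set W)) := weight_mono hx hs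
    linarith

variable [DecidableEq W]

/-- A lower bound for the number of edges in an induced subgraph `R` with no node of degree one,
in which the nodes outside of `Y` are incident either to no contained edge, or to many. -/
lemma IsSpanningTreePoint.two_mul_card_sdiff_le (h : IsSpanningTreePoint a b x) (D : W → Set F)
    (hD : ∀ w, D w ⊆ edgesAt a b w) (F₂ : Set F) (hF₂ : F₂ = {f | f ∈ D (a f) ∧ f ∈ D (b f)})
    (Y R M : Finset W) (hY : ∀ f ∈ F₂, a f ∈ Y ∧ b f ∈ Y) (hR1 : 1 < R.card)
    (hR : weight x (edgesWithin a b R) = (R.card : ℝ) - 1)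
    (hdeg : ∀ v ∈ R, weight x (edgesAt a b v ∩ edgesWithin a b R) ≠ 1)
    (hM : M ⊆ R \ Y)
    (hB : ∀ v ∈ (R \ Y) \ M, 4 ≤ weight (fun f => 1 - x f) (D v ∩ edgesWithin a b R)) :
    2 * ((R \ Y).card : ℝ) ≤ (edgesWithin a b R \ F₂).ncard +
      (weight x Set.univ - (pieces (graphicTightSets a b x)).card) +
      weight x (edgesWithin a b M) + 1 := by
  classical
  have hx : ∀ f, 0 ≤ x f := fun f => (h.pos f).le
  have hx' : ∀ f, 0 ≤ 1 - x f := fun f => by linarith [h.lt_one f]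
  set E := edgesWithin a b (R : Set W) with hEdef
  set E₀ := edgesWithin a b (M : Set W) with hE₀def
  set G := E \ F₂ with hG
  have hMR : ∀ v ∈ M, v ∈ R ∧ v ∉ Y := fun v hv => Finset.mem_sdiff.1 (hM hv)
  have hE₀G : E₀ ⊆ G := fun f hf =>
    ⟨⟨(hMR _ hf.1).1, (hMR _ hf.2).1⟩, fun hf2 => (hMR _ hf.1).2 (hY f hf2).1⟩
  have hEt : E ∈ graphicTightSets a b x := by
    have hne : (R : Set W).Nonempty := Finset.card_pos.1 (by omega)
    exact h.edgesWithin_mem hne (by rw [hR, Set.ncard_coe_finset])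
  -- contained edges at the nodes outside of `Y` and `M`
  have hA : 4 * (((R \ Y) \ M).card : ℝ) ≤ weight (fun f => 1 - x f) (G \ E₀) := by
    have h1 : ∑ v ∈ (R \ Y) \ M, (4 : ℝ) ≤
        ∑ v ∈ (R \ Y) \ M, weight (fun f => 1 - x f) (D v ∩ E) := Finset.sum_le_sum hB
    have h2 : ∑ v ∈ (R \ Y) \ M, weight (fun f => 1 - x f) (D v ∩ E) ≤
        weight (fun f => 1 - x f) (G \ E₀) := by
      -- Away from `Y` no edge is in `F₂`, which makes the sets `D v` disjoint for the nodes counted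
      -- here.
      have hvY : ∀ v ∈ (R \ Y) \ M, ∀ f ∈ D v, f ∉ F₂ := by
        intro v hv f hf hf2
        simp only [Finset.mem_sdiff] at hv
        rcases hD v hf with rfl | rfl
        · exact hv.1.2 (hY f hf2).1
        · exact hv.1.2 (hY f hf2).2
      refine sum_weight_le_of_disjoint _ hx' _ _ (fun v hv f hf => ?_) fun v hv w hw f hf hf' => ?_
      · refine ⟨⟨hf.2, hvY v hv f hf.1⟩, fun hf0 => ?_⟩
        simp only [Finset.mem_sdiff] at hv
        rcases hD v hf.1 with rfl | rfl
        · exact hv.2 hf0.1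
        · exact hv.2 hf0.2
      · have hnot := hvY v hv f hf.1
        rw [hF₂] at hnot
        rcases hD v hf.1 with rfl | rfl <;> rcases hD w hf'.1 with h' | h'
        · exact h'
        · subst h'
          exact absurd ⟨hf.1, hf'.1⟩ hnot
        · subst h'
          exact absurd ⟨hf'.1, hf.1⟩ hnot
        · exact h'
    rw [Finset.sum_const, nsmul_eq_mul] at h1
    linarith
  have hcount : (G \ E₀).ncard + E₀.ncard = G.ncard :=
    Set.ncard_sdiff_add_ncard_of_subset hE₀G
  have hcount' : ((G \ E₀).ncard : ℝ) + E₀.ncard = G.ncard := by exact_mod_cast hcount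
  rw [weight_one_sub, weight_sdiff x hE₀G] at hA
  have hG' := weight_inter_add_sdiff x E F₂
  have hEF₂ : weight x (E ∩ F₂) ≤ (R ∩ Y).card :=
    h.weight_inter_le_card _ _ fun f hf => by
      simp only [Finset.mem_inter]
      exact ⟨⟨hf.1.1, (hY f hf.2).1⟩, ⟨hf.1.2, (hY f hf.2).2⟩⟩
  -- degrees of the nodes in `M`
  have hedge : ∀ v ∈ M, edgesAt a b v ∩ E = edgesAt a b v ∩ G := by
    intro v hv
    refine Set.Subset.antisymm (fun f hf => ⟨hf.1, hf.2, fun hf2 => ?_⟩)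
      (Set.inter_subset_inter_right _ Set.sdiff_subset)
    rcases hf.1 with rfl | rfl
    · exact (hMR _ hv).2 (hY f hf2).1
    · exact (hMR _ hv).2 (hY f hf2).2
  -- Tightness of `R` gives at least 1, and `hdeg` excludes equality. All edges are below 1, so the
  -- degree is at least 2.
  have hgt : ∀ v ∈ M, 1 < weight x (edgesAt a b v ∩ E) := fun v hv =>
    lt_of_le_of_ne (h.one_le_weight_edgesAt hR hR1 (hMR v hv).1) (hdeg v (hMR v hv).1).symm
  have htwo : ∀ v ∈ M, 2 ≤ (edgesAt a b v ∩ E).ncard := by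
    intro v hv
    have h1 := hgt v hv
    have h2 := weight_nonneg hx' (edgesAt a b v ∩ E)
    rw [weight_one_sub] at h2
    have : (1 : ℝ) < (edgesAt a b v ∩ E).ncard := by linarith
    exact_mod_cast this
  set M₂ : Finset W := {v ∈ M | (edgesAt a b v ∩ E).ncard = 2} with hM₂
  have hM₂card := h.card_degree_two_le hEt M₂ (fun v hv => (Finset.mem_filter.1 hv).2)
    fun v hv => hgt v (Finset.mem_filter.1 hv).1
  have hM₂E₀ : weight x (E ∩ edgesWithin a b (M₂ : Set W)) ≤ weight x E₀ :=
    weight_mono hx fun f hf =>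
      ⟨(Finset.mem_filter.1 hf.2.1).1, (Finset.mem_filter.1 hf.2.2).1⟩
  -- Handshake over `M`: edges inside `M` count twice, and nodes of degree two fall short of 3 by
  -- one.
  have hsum : 3 * (M.card : ℝ) - M₂.card ≤ G.ncard + E₀.ncard := by
    have h1 := sum_weight_edgesAt_inter_le (a := a) (b := b) (x := fun _ => 1)
      (fun _ => zero_le_one) M G G fun w _ => Set.inter_subset_right
    have h2 : weight (fun _ => 1) (G ∩ (G ∩ edgesWithin a b (M : Set W))) ≤
        weight (fun _ => 1) E₀ := weight_mono (fun _ => zero_le_one) fun f hf => hf.2.2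
    have h3 : ∑ v ∈ M, (3 - if (edgesAt a b v ∩ E).ncard = 2 then (1 : ℝ) else 0) ≤
        ∑ v ∈ M, weight (fun _ => 1) (edgesAt a b v ∩ G) := by
      refine Finset.sum_le_sum fun v hv => ?_
      rw [← hedge v hv, weight_one]
      have := htwo v hv
      split_ifs with h2
      · rw [h2]; norm_num
      · have : 3 ≤ (edgesAt a b v ∩ E).ncard := by omega
        rw [sub_zero]
        exact_mod_cast this
    rw [Finset.sum_sub_distrib, Finset.sum_const, nsmul_eq_mul, Finset.sum_boole] at h3
    rw [weight_one, weight_one] at h1 h2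
    linarith
  have hc1 : (((R \ Y) \ M).card : ℝ) + M.card = (R \ Y).card := by
    exact_mod_cast Finset.card_sdiff_add_card_eq_card hM
  have hc2 : ((R \ Y).card : ℝ) + (R ∩ Y).card = R.card := by
    exact_mod_cast Finset.card_sdiff_add_card_inter R Y
  have hl := h.isRing.card_pieces_le h.pos exists_int_weight_of_mem_graphicTightSets
  rw [h.sUnion_eq] at hl
  have hnn := weight_nonneg hx E₀
  -- Adding `hA` and `hsum` cancels |E₀|. With x(G) ≥ |R \ Y| - 1 and the bound on |M₂| this is
  -- twice the claim, with room to spare.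
  linarith [(Nat.cast_nonneg ((R \ Y) \ M).card : (0 : ℝ) ≤ _)]

/-- The counting argument, when some edge is contained in both degree constraints. -/
lemma IsSpanningTreePoint.card_lt (h : IsSpanningTreePoint a b x) (D : W → Set F)
    (hD : ∀ w, D w ⊆ edgesAt a b w) (F₂ : Set F) (hF₂ : F₂ = {f | f ∈ D (a f) ∧ f ∈ D (b f)})
    (Y R : Finset W) (hY : ∀ f ∈ F₂, a f ∈ Y ∧ b f ∈ Y) (hYne : Y.Nonempty) (hRne : R.Nonempty)
    (hR : weight x (edgesWithin a b R) = (R.card : ℝ) - 1)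
    (hQ : 2 * (Rᶜ \ Y).card ≤ ((edgesWithin a b R)ᶜ \ F₂).ncard)
    (hdeg : ∀ v ∈ R, weight x (edgesAt a b v ∩ edgesWithin a b R) ≠ 1)
    (hB : ∀ v ∈ R, D v ∩ edgesWithin a b R = ∅ ∨
      4 < weight (fun f => 1 - x f) (D v ∩ edgesWithin a b R))
    (hA : ∀ v ∈ Y, 4 < weight (fun f => 1 - x f) (edgesAt a b v ∩ F₂)) :
    ((pieces (graphicTightSets a b x)).card : ℝ) + ∑ w, weight x (D w) < Fintype.card F := by
  classical
  have hx : ∀ f, 0 ≤ x f := fun f => (h.pos f).le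
  have hx' : ∀ f, 0 ≤ 1 - x f := fun f => by linarith [h.lt_one f]
  set E := edgesWithin a b (R : Set W) with hEdef
  set M : Finset W := {v ∈ R \ Y | D v ∩ E = ∅} with hM
  have hMD : ∀ v ∈ M, D v ∩ E = ∅ := fun v hv => (Finset.mem_filter.1 hv).2
  have hMR : ∀ v ∈ M, v ∈ R := fun v hv =>
    (Finset.mem_sdiff.1 (Finset.mem_filter.1 hv).1).1
  -- The constant 2 also covers |R| = 1, and it is what 2(|W| - 1) = 2x(F) can absorb at the end.
  have hkey : 2 * ((R \ Y).card : ℝ) ≤ (E \ F₂).ncard +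
      (weight x Set.univ - (pieces (graphicTightSets a b x)).card) +
      weight x (edgesWithin a b M) + 2 := by
    rcases (Nat.succ_le_of_lt hRne.card_pos).lt_or_eq with hR1 | hR1
    · have := h.two_mul_card_sdiff_le D hD F₂ hF₂ Y R M hY hR1 hR hdeg
        (Finset.filter_subset _ _) fun v hv => by
          simp only [hM, Finset.mem_sdiff, Finset.mem_filter, not_and] at hv
          exact ((hB v hv.1.1).resolve_left (hv.2 hv.1)).le
      linarith
    · have h1 : (R \ Y).card ≤ 1 := (Finset.card_le_card Finset.sdiff_subset).trans_eq hR1.symm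
      have h1' : ((R \ Y).card : ℝ) ≤ 1 := by exact_mod_cast h1
      have h2 := h.isRing.card_pieces_le h.pos exists_int_weight_of_mem_graphicTightSets
      rw [h.sUnion_eq] at h2
      have h3 := weight_nonneg hx (edgesWithin a b (M : Set W))
      have h4 : (0 : ℝ) ≤ (E \ F₂).ncard := Nat.cast_nonneg _
      linarith
  have hDsum := sum_weight_contained_le hx D hD (edgesWithin a b (M : Set W)) fun f hf w hfw => by
    have hfE : f ∈ E := ⟨hMR _ hf.1, hMR _ hf.2⟩
    rcases hD w hfw with rfl | rfl
    · exact (hMD _ hf.1).subset ⟨hfw, hfE⟩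
    · exact (hMD _ hf.2).subset ⟨hfw, hfE⟩
  rw [← hF₂] at hDsum
  -- Each edge of `F₂` has two ends, both in `Y`. The inequality is strict because `Y` is nonempty.
  have hYsum : 4 * (Y.card : ℝ) < 2 * (F₂.ncard - weight x F₂) := by
    have h1 : ∑ v ∈ Y, (4 : ℝ) < ∑ v ∈ Y, weight (fun f => 1 - x f) (edgesAt a b v ∩ F₂) :=
      Finset.sum_lt_sum_of_nonempty hYne hA
    have h2 := sum_weight_edgesAt_inter_le_two_mul (a := a) (b := b) hx' Y F₂
    rw [weight_one_sub] at h2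
    rw [Finset.sum_const, nsmul_eq_mul] at h1
    linarith
  have hF : (Fintype.card F : ℝ) = (E \ F₂).ncard + (Eᶜ \ F₂).ncard + F₂.ncard := by
    have h1 := weight_inter_add_sdiff (fun _ => (1 : ℝ)) Set.univ F₂
    have h2 := weight_inter_add_sdiff (fun _ => (1 : ℝ)) (Set.univ \ F₂) E
    have e1 : (Set.univ \ F₂) ∩ E = E \ F₂ := by ext; simp [and_comm]
    have e2 : (Set.univ \ F₂) \ E = Eᶜ \ F₂ := by ext; simp [and_comm]
    rw [e1, e2] at h2
    simp only [weight_one, Set.univ_inter, Set.ncard_univ, Nat.card_eq_fintype_card] at h1 h2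
    linarith
  have hW : Fintype.card W = (Rᶜ \ Y).card + (R \ Y).card + Y.card := by
    have h1 := Finset.card_sdiff_add_card_inter R Y
    have h2 := Finset.card_sdiff_add_card_inter Rᶜ Y
    have h3 := Finset.card_add_card_compl R
    have h4 := Finset.card_sdiff_add_card_inter Y R
    have h5 : Rᶜ ∩ Y = Y \ R := by ext; simp [and_comm]
    rw [h5] at h2
    rw [Finset.inter_comm] at h4
    omega
  have hW' : (Fintype.card W : ℝ) = (Rᶜ \ Y).card + (R \ Y).card + Y.card := by exact_mod_cast hW
  have hQ' : 2 * ((Rᶜ \ Y).card : ℝ) ≤ (Eᶜ \ F₂).ncard := by exact_mod_cast hQ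
  have := h.weight_univ
  linarith

end Contradiction

/-! ### Basic solutions in terms of chosen edge ends, and the construction of Q -/

section Main

variable {W F : Type*} {H : Graph W F} {a b : F → W}

lemma inducedEdges_eq (hab : ∀ f, H.IsLink f (a f) (b f)) (L : Set W) :
    inducedEdges H L = edgesWithin a b L := by
  ext f
  rw [inducedEdges, Graph.edgeSet_induce]
  constructor
  · rintro ⟨u, v, h, hu, hv⟩
    rcases (hab f).eq_and_eq_or_eq_and_eq h with ⟨h1, h2⟩ | ⟨h1, h2⟩
    · exact ⟨h1 ▸ hu, h2 ▸ hv⟩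
    · exact ⟨h1 ▸ hv, h2 ▸ hu⟩
  · exact fun h => ⟨a f, b f, hab f, h⟩

lemma inc_iff (hab : ∀ f, H.IsLink f (a f) (b f)) (f : F) (w : W) :
    H.Inc f w ↔ a f = w ∨ b f = w := by
  constructor
  · intro h
    rcases h.eq_or_eq_of_isLink (hab f) with rfl | rfl <;> simp
  · rintro (rfl | rfl)
    · exact (hab f).inc_left
    · exact (hab f).inc_right

lemma incidenceSet_eq (hab : ∀ f, H.IsLink f (a f) (b f)) (w : W) :
    H.incidenceSet w = edgesAt a b w := by
  ext f
  exact inc_iff hab f w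

lemma edgesInBoth_eq (hab : ∀ f, H.IsLink f (a f) (b f)) (N : W → Matroid F) :
    edgesInBoth H N = {f | IsContained (N (a f)) f ∧ IsContained (N (b f)) f} := by
  ext f
  constructor
  · exact fun h => ⟨h.2 _ (hab f).inc_left, h.2 _ (hab f).inc_right⟩
  · refine fun h => ⟨(hab f).edge_mem, fun w hw => ?_⟩
    rcases (inc_iff hab f w).1 hw with rfl | rfl
    · exact h.1
    · exact h.2

lemma mem_nodesY_of_mem_edgesInBoth {N : W → Matroid F} {f : F} (hf : f ∈ edgesInBoth H N) {w : W}
    (hw : H.Inc f w) : w ∈ nodesY H N :=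
  ⟨hw.vertex_mem, f, hw, hf⟩

variable [Fintype W] [Fintype F] {N : W → Matroid F} {fixed : Set (Set W)} {x : F → ℝ}

lemma IsBasicSolution.isSpanningTreePoint (hV : H.vertexSet = Set.univ)
    (hE : H.edgeSet = Set.univ) (hx : IsBasicSolution H N fixed x) (hx0 : ∀ f, x f ≠ 0)
    (hx1 : ∀ f, x f ≠ 1) (hab : ∀ f, H.IsLink f (a f) (b f)) : IsSpanningTreePoint a b x := by
  obtain ⟨⟨h1, h2, h3⟩, -, -⟩ := hx.1
  have hpos : ∀ f, 0 < x f := fun f => (h1 f).lt_of_ne (hx0 f).symm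
  have hle : ∀ L : Set W, L.Nonempty → weight x (edgesWithin a b L) ≤ (L.ncard : ℝ) - 1 := by
    intro L hL
    rw [← inducedEdges_eq hab]
    exact h3 L hL (hV ▸ Set.subset_univ _)
  refine ⟨hpos, fun f => lt_of_le_of_ne ?_ (hx1 f), ?_, hle⟩
  · have h4 := hle {a f, b f} (Set.insert_nonempty _ _)
    have h5 : (({a f, b f} : Set W).ncard : ℝ) ≤ 2 := by
      exact_mod_cast (Set.ncard_insert_le _ _).trans (by simp)
    have h6 := le_weight h1 (show f ∈ edgesWithin a b {a f, b f} by simp [edgesWithin])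
    linarith
  · rw [hE, hV, Set.ncard_univ, Nat.card_eq_fintype_card] at h2
    exact h2

/-- A direction that vanishes on the pieces of all constraints is zero. -/
lemma IsBasicSolution.eq_zero_of_pieces [DecidableEq W]
    (hE : H.edgeSet = Set.univ) (hab : ∀ f, H.IsLink f (a f) (b f))
    (hx : IsBasicSolution H N fixed x) (h : IsSpanningTreePoint a b x)
    (hfixed : ∀ L ∈ fixed, L.Nonempty) {d : F → ℝ}
    (hST : ∀ P ∈ pieces (graphicTightSets a b x), weight d P = 0)
    (hN : ∀ w, ∀ P ∈ pieces (tightSets (N w) x), weight d P = 0) : d = 0 := by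
  refine hx.eq_zero h.pos ?_ (fun L hL hLx => ?_) hfixed fun w C hC hCx => ?_
  · rw [hE]
    exact weight_eq_zero_of_pieces hST h.univ_mem
  · rw [inducedEdges_eq hab] at hLx ⊢
    exact weight_eq_zero_of_pieces hST (h.edgesWithin_mem hL hLx)
  · exact weight_eq_zero_of_pieces (hN w) ⟨hC, hCx⟩

lemma IsBasicSolution.card_le [DecidableEq W]
    (hE : H.edgeSet = Set.univ) (hab : ∀ f, H.IsLink f (a f) (b f))
    (hx : IsBasicSolution H N fixed x) (h : IsSpanningTreePoint a b x)
    (hfixed : ∀ L ∈ fixed, L.Nonempty) :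
    Fintype.card F ≤ (pieces (graphicTightSets a b x)).card +
      ∑ w, (pieces (tightSets (N w) x)).card := by
  classical
  refine (card_le_of_weight_injective (pieces (graphicTightSets a b x) ∪
    Finset.univ.biUnion fun w => pieces (tightSets (N w) x)) fun d hd => ?_).trans
    ((Finset.card_union_le _ _).trans (Nat.add_le_add_left Finset.card_biUnion_le _))
  exact hx.eq_zero_of_pieces hE hab h hfixed
    (fun P hP => hd P (Finset.mem_union_left _ hP))
    fun w P hP => hd P (Finset.mem_union_right _ (Finset.mem_biUnion.2 ⟨w, Finset.mem_univ _, hP⟩))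

lemma isContained_of_mem_sUnion (hV : H.vertexSet = Set.univ)
    (hx : IsBasicSolution H N fixed x) (h : IsSpanningTreePoint a b x) {w : W} {f : F}
    (hf : f ∈ ⋃₀ tightSets (N w) x) : IsContained (N w) f := by
  obtain ⟨C, hC, hfC⟩ := hf
  exact isContained_of_mem_tightSets (hx.1.2.1 w (hV ▸ Set.mem_univ w)) hC hfC (h.lt_one f)

/-- In a fractional basic solution, some edge is contained in both degree constraints. -/
lemma IsBasicSolution.edgesInBoth_nonempty (hV : H.vertexSet = Set.univ)
    (hE : H.edgeSet = Set.univ) (hab : ∀ f, H.IsLink f (a f) (b f))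
    (hN : ∀ w, (N w).E = H.incidenceSet w)
    (hx : IsBasicSolution H N fixed x) (h : IsSpanningTreePoint a b x)
    (hfixed : ∀ L ∈ fixed, L.Nonempty) (hW : 1 < Fintype.card W) :
    (edgesInBoth H N).Nonempty := by
  classical
  by_contra hemp
  rw [Set.not_nonempty_iff_eq_empty] at hemp
  have hx' : ∀ f, 0 < 1 - x f := fun f => by linarith [h.lt_one f]
  have hmat : ∀ w, x ∈ matroidPolytope (N w) := fun w => hx.1.2.1 w (hV ▸ Set.mem_univ w)
  set U : W → Set F := fun w => ⋃₀ tightSets (N w) x with hU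
  have hUD : ∀ w f, f ∈ U w → IsContained (N w) f := fun w f hf =>
    isContained_of_mem_sUnion hV hx h hf
  have hdisj : ∀ u v f, f ∈ U u → f ∈ U v → u = v := by
    intro u v f hu hv
    by_contra huv
    have hu' := hUD u f hu
    have hv' := hUD v f hv
    have hui := hu'.1
    have hvi := hv'.1
    rw [hN, incidenceSet_eq hab] at hui hvi
    have : f ∈ edgesInBoth H N := by
      rw [edgesInBoth_eq hab]
      rcases hui with rfl | rfl <;> rcases hvi with rfl | rfl
      · exact absurd rfl huv
      · exact ⟨hu', hv'⟩
      · exact ⟨hv', hu'⟩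
      · exact absurd rfl huv
    rw [hemp] at this
    exact this
  -- Tight sets also have integral weight under the positive function 1 - x. Together with l ≤ x(F),
  -- this bounds the number of atoms by |F|.
  have hk : ∑ w, ((pieces (tightSets (N w) x)).card : ℝ) ≤
      ∑ w, weight (fun f => 1 - x f) (U w) := by
    refine Finset.sum_le_sum fun w _ => (isRing_tightSets (hmat w)).card_pieces_le hx' ?_
    intro S hS
    obtain ⟨n, hn⟩ := exists_int_weight_of_mem_tightSets S hS
    exact ⟨S.ncard - n, by rw [weight_one_sub, hn]; push_cast; ring⟩
  have hsum : ∑ w, weight (fun f => 1 - x f) (U w) ≤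
      weight (fun f => 1 - x f) (⋃ w, U w) :=
    sum_weight_le_of_disjoint _ (fun f => (hx' f).le) _ _
      (fun w _ => Set.subset_iUnion U w) fun u _ v _ => hdisj u v
  have hst := h.isRing.card_pieces_le h.pos exists_int_weight_of_mem_graphicTightSets
  rw [h.sUnion_eq] at hst
  have hcard := hx.card_le hE hab h hfixed
  have hcard' : (Fintype.card F : ℝ) ≤ (pieces (graphicTightSets a b x)).card +
      ∑ w, ((pieces (tightSets (N w) x)).card : ℝ) := by exact_mod_cast hcard
  have hdiff := weight_sdiff (fun f => 1 - x f) (Set.subset_univ (⋃ w, U w))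
  have htot : weight (fun f => 1 - x f) Set.univ = Fintype.card F - weight x Set.univ := by
    rw [weight_one_sub, Set.ncard_univ, Nat.card_eq_fintype_card]
  -- An uncovered edge would contribute a positive loss 1 - x(f), bringing the number of atoms below
  -- |F|.
  have hcover : (⋃ w, U w) = Set.univ := by
    by_contra hne
    have hne' : (Set.univ \ ⋃ w, U w).Nonempty := by
      rw [Set.sdiff_nonempty]
      exact fun hsub => hne (Set.eq_univ_of_univ_subset hsub)
    have := weight_pos hx' hne'
    linarith
  have hF : Nonempty F := by
    by_contra hF
    rw [not_nonempty_iff] at hF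
    have h1 := h.weight_univ
    rw [weight_univ, Finset.univ_eq_empty, Finset.sum_empty] at h1
    have : (1 : ℝ) < Fintype.card W := by exact_mod_cast hW
    linarith
  obtain ⟨e⟩ := hF
  set P₀ := piece (graphicTightSets a b x) e with hP₀
  have hP₀mem : P₀ ∈ pieces (graphicTightSets a b x) :=
    piece_mem_pieces (by rw [h.sUnion_eq]; trivial)
  -- Spanning tree atoms and degree atoms both partition F, so their indicator vectors have equal
  -- sums and one spanning tree atom is redundant.
  have hlt : Fintype.card F ≤ ((pieces (graphicTightSets a b x)).erase P₀).card +
      ∑ w, (pieces (tightSets (N w) x)).card := by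
    refine (card_le_of_weight_injective ((pieces (graphicTightSets a b x)).erase P₀ ∪
      Finset.univ.biUnion fun w => pieces (tightSets (N w) x)) fun d hd => ?_).trans
      ((Finset.card_union_le _ _).trans (Nat.add_le_add_left Finset.card_biUnion_le _))
    have hdN : ∀ w, ∀ P ∈ pieces (tightSets (N w) x), weight d P = 0 := fun w P hP =>
      hd P (Finset.mem_union_right _ (Finset.mem_biUnion.2 ⟨w, Finset.mem_univ _, hP⟩))
    have hdST : ∀ P ∈ pieces (graphicTightSets a b x), P ≠ P₀ → weight d P = 0 := fun P hP hne =>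
      hd P (Finset.mem_union_left _ (Finset.mem_erase.2 ⟨hne, hP⟩))
    have hduniv : weight d Set.univ = 0 := by
      have h1 : weight d Set.univ = ∑ w, weight d (U w) := by
        rw [sum_weight, weight_univ]
        refine Finset.sum_congr rfl fun f _ => ?_
        have hf : f ∈ ⋃ w, U w := hcover ▸ Set.mem_univ f
        obtain ⟨w, hw⟩ := Set.mem_iUnion.1 hf
        have : ({i | f ∈ U i} : Finset W) = {w} := by
          ext v
          simp only [Finset.mem_filter, Finset.mem_univ, true_and, Finset.mem_singleton]
          exact ⟨fun hv => hdisj v w f hv hw, fun hv => hv ▸ hw⟩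
        rw [this]
        simp
      rw [h1]
      refine Finset.sum_eq_zero fun w _ => ?_
      rw [hU, weight_sUnion_eq_sum_pieces]
      exact Finset.sum_eq_zero (hdN w)
    have hP₀zero : weight d P₀ = 0 := by
      rw [← h.sUnion_eq, weight_sUnion_eq_sum_pieces, Finset.sum_eq_single P₀ hdST
        fun hn => absurd hP₀mem hn] at hduniv
      exact hduniv
    refine hx.eq_zero_of_pieces hE hab h hfixed (fun P hP => ?_) hdN
    by_cases hPP : P = P₀
    · rw [hPP, hP₀zero]
    · exact hdST P hP hPP
  have herase := Finset.card_erase_add_one hP₀mem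
  have hlt' : (Fintype.card F : ℝ) + 1 ≤ (pieces (graphicTightSets a b x)).card +
      ∑ w, ((pieces (tightSets (N w) x)).card : ℝ) := by
    have : Fintype.card F + 1 ≤ (pieces (graphicTightSets a b x)).card +
      ∑ w, (pieces (tightSets (N w) x)).card := by omega
    exact_mod_cast this
  rw [hcover] at hsum
  linarith

/-- The invariants of the construction of `Q`: the remaining nodes form a nonempty tight set, and
every node of `Q` that is not incident to an edge of `F₂` accounts for two edges outside of
`F₂`. -/
lemma IsPartialQ.invariants (hV : H.vertexSet = Set.univ)
    (hab : ∀ f, H.IsLink f (a f) (b f)) (h : IsSpanningTreePoint a b x) (Y : Set W) (F₂ : Set F)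
    (hY : ∀ f ∈ F₂, a f ∈ Y ∧ b f ∈ Y) {Q : Set W} (hQ : IsPartialQ H x Q) :
    Qᶜ.Nonempty ∧ weight x (edgesWithin a b Qᶜ) = (Qᶜ.ncard : ℝ) - 1 ∧
      2 * (Q \ Y).ncard ≤ ((edgesWithin a b Qᶜ)ᶜ \ F₂).ncard := by
  induction hQ with
  | empty =>
    have := h.nonempty
    refine ⟨by simp, ?_, by simp⟩
    have huniv : edgesWithin a b ∅ᶜ = Set.univ := by simp [edgesWithin]
    rw [huniv, h.weight_univ, Set.compl_empty, Set.ncard_univ, Nat.card_eq_fintype_card]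
  | add Q w _ _ hwQ hw ih =>
    obtain ⟨-, ih2, ih3⟩ := ih
    rw [hV, ← Set.compl_eq_univ_sdiff, inducedEdges_eq hab, incidenceSet_eq hab] at hw
    have hcompl : (insert w Q)ᶜ = Qᶜ \ {w} := by
      ext v
      simp only [Set.mem_compl_iff, Set.mem_insert_iff, Set.mem_sdiff, Set.mem_singleton_iff]
      tauto
    rw [hcompl, edgesWithin_sdiff_singleton]
    set E := edgesWithin a b Qᶜ with hEdef
    set O := edgesAt a b w ∩ E with hO
    have hOE : O ⊆ E := Set.inter_subset_right
    refine ⟨?_, ?_, ?_⟩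
    · by_contra hemp
      rw [Set.not_nonempty_iff_eq_empty, Set.sdiff_eq_empty] at hemp
      -- If `w` were the last remaining node, its edges would be loops, and there are none.
      have : O = ∅ := by
        refine Set.eq_empty_of_forall_notMem fun f hf => h.ne f ?_
        exact (hemp hf.2.1).trans (hemp hf.2.2).symm
      rw [this, weight_empty] at hw
      exact zero_ne_one hw
    · have h2 := Set.ncard_sdiff_singleton_add_one (show w ∈ Qᶜ from hwQ) (Set.toFinite _)
      have h3 : ((Qᶜ \ {w}).ncard : ℝ) + 1 = Qᶜ.ncard := by exact_mod_cast h2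
      rw [weight_sdiff x hOE, ih2, hw]
      linarith
    · have hsplit : (E \ O)ᶜ \ F₂ = (Eᶜ \ F₂) ∪ (O \ F₂) := by
        ext f
        have := @hOE f
        simp only [Set.mem_sdiff, Set.mem_compl_iff, Set.mem_union]
        tauto
      have hdisj : Disjoint (Eᶜ \ F₂) (O \ F₂) :=
        Set.disjoint_left.2 fun f hf hf' => hf.1 (hOE hf'.1)
      rw [hsplit, Set.ncard_union_eq hdisj]
      by_cases hwY : w ∈ Y
      · rw [Set.insert_sdiff_of_mem _ hwY]
        omega
      · rw [Set.insert_sdiff_of_notMem _ hwY,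
          Set.ncard_insert_of_notMem fun hmem => hwQ hmem.1]
        have hOF : O \ F₂ = O := by
          refine sdiff_eq_left.2 (Set.disjoint_left.2 fun f hf hf2 => hwY ?_)
          rcases hf.1 with rfl | rfl
          · exact (hY f hf2).1
          · exact (hY f hf2).2
        have hOne : O.Nonempty := by
          by_contra hemp
          rw [Set.not_nonempty_iff_eq_empty] at hemp
          rw [hemp, weight_empty] at hw
          exact zero_ne_one hw
        have hpos := weight_pos (x := fun f => 1 - x f) (fun f => by linarith [h.lt_one f]) hOne
        rw [weight_one_sub, hw] at hpos
        -- Weight exactly 1 made of values below 1 takes at least two edges; they avoid `F₂` because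
        -- `w` is not in `Y`.
        have : 1 < O.ncard := by
          have : (1 : ℝ) < O.ncard := by linarith
          exact_mod_cast this
        rw [hOF]
        omega

end Main

end MatroidalMST

theorem mainTheorem2 {W F : Type*} [Fintype W] [Fintype F]
    (H : Graph W F) (hV : H.vertexSet = Set.univ) (hE : H.edgeSet = Set.univ)
    (N : W → Matroid F) (hN : ∀ w, (N w).E = H.incidenceSet w)
    (fixed : Set (Set W)) (hfixed : ∀ L ∈ fixed, L.Nonempty)
    (x : F → ℝ) (hx : MatroidalMST.IsBasicSolution H N fixed x)
    (hx0 : ∀ f, x f ≠ 0) (hx1 : ∀ f, x f ≠ 1)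
    (Q : Set W) (hQ : MatroidalMST.IsQ H x Q)
    (hW : 1 < Fintype.card W)
    (hB : ∀ w, ¬ MatroidalMST.TypeBApplicable H N x Q w) :
    ∃ w ∈ MatroidalMST.nodesY H N, MatroidalMST.TypeAApplicable H N x w := by
  classical
  open MatroidalMST in
  by_contra! hA
  choose a b hab using fun f => H.exists_isLink_of_mem_edgeSet (hE ▸ Set.mem_univ f)
  have h := hx.isSpanningTreePoint hV hE hx0 hx1 hab
  have hmat : ∀ w, x ∈ matroidPolytope (N w) := fun w => hx.1.2.1 w (hV ▸ Set.mem_univ w)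
  have hY : ∀ f ∈ edgesInBoth H N, a f ∈ nodesY H N ∧ b f ∈ nodesY H N := fun f hf =>
    ⟨mem_nodesY_of_mem_edgesInBoth hf (hab f).inc_left,
      mem_nodesY_of_mem_edgesInBoth hf (hab f).inc_right⟩
  obtain ⟨hQ1, hQ2, hQ3⟩ := hQ.1.invariants hV hab h _ _ hY
  obtain ⟨f₀, hf₀⟩ := hx.edgesInBoth_nonempty hV hE hab hN h hfixed hW
  let Yf : Finset W := (nodesY H N).toFinset
  let R : Finset W := Qᶜ.toFinset
  have hRcoe : (R : Set W) = Qᶜ := Set.coe_toFinset _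
  have hRcard : R.card = Qᶜ.ncard := by rw [← hRcoe, Set.ncard_coe_finset]
  have hQY : (Rᶜ \ Yf).card = (Q \ nodesY H N).ncard := by
    rw [← Set.ncard_coe_finset, Finset.coe_sdiff, Finset.coe_compl, hRcoe, compl_compl,
      Set.coe_toFinset]
  have hlt := h.card_lt (fun w => {f | IsContained (N w) f})
    (fun w f hf => incidenceSet_eq hab w ▸ hN w ▸ hf.1) (edgesInBoth H N) (edgesInBoth_eq hab N)
    Yf R (fun f hf => by simpa [Yf] using hY f hf) ⟨a f₀, by simpa [Yf] using (hY f₀ hf₀).1⟩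
    (by rwa [← Finset.coe_nonempty, hRcoe]) (by rw [hRcoe, hRcard, hQ2])
    (by rw [hRcoe, hQY]; exact hQ3)
    (fun v hv => by
      have h1 := hQ.2 v (hV ▸ Set.mem_univ v) (by simpa [R] using hv)
      rwa [hV, ← Set.compl_eq_univ_sdiff, inducedEdges_eq hab, incidenceSet_eq hab,
        ← hRcoe] at h1)
    (fun v hv => by
      have hset : {f | IsContained (N v) f} ∩ edgesWithin a b (R : Set W) = typeBSet H N Q v := by
        rw [hRcoe]
        ext f
        constructor
        · rintro ⟨h1, h2⟩
          refine ⟨hN v ▸ h1.1, h1, fun q hq hfq => ?_⟩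
          rcases (inc_iff hab f q).1 hfq with rfl | rfl
          · exact h2.1 hq
          · exact h2.2 hq
        · rintro ⟨-, h1, h2⟩
          exact ⟨h1, fun hq => h2 _ hq (hab f).inc_left, fun hq => h2 _ hq (hab f).inc_right⟩
      rw [hset, weight_one_sub]
      rcases (typeBSet H N Q v).eq_empty_or_nonempty with hemp | hne
      · exact Or.inl hemp
      · exact Or.inr (not_le.1 fun hle => hB v ⟨hne, hle⟩))
    (fun v hv => by
      have hvY : v ∈ nodesY H N := by simpa [Yf] using hv
      rw [← incidenceSet_eq hab, weight_one_sub]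
      exact not_le.1 fun hle => hA v hvY ⟨hvY.2, hle⟩)
  have hcard : (Fintype.card F : ℝ) ≤ (pieces (graphicTightSets a b x)).card +
      ∑ w, ((pieces (tightSets (N w) x)).card : ℝ) := by
    exact_mod_cast hx.card_le hE hab h hfixed
  -- Here the atoms are weighed by `x`, unlike in the proof that `F₂` is nonempty.
  have hk : ∑ w, ((pieces (tightSets (N w) x)).card : ℝ) ≤
      ∑ w, weight x {f | IsContained (N w) f} :=
    Finset.sum_le_sum fun w _ => ((isRing_tightSets (hmat w)).card_pieces_le h.pos
      exists_int_weight_of_mem_tightSets).trans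
      (weight_mono (fun f => (h.pos f).le) fun f hf => isContained_of_mem_sUnion hV hx h hf)
  linarith
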